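/- Let $n > 2$ and let $L = \sum_{k=1}^{n} a_k(x) D^k$, $D = d/dx$, where each $a_k$ is a real polynomial of degree at most $k$ and $a_n \not\equiv 0$. Let $I \subseteq \mathbb{R}$ be a nondegenerate interval (bounded or unbounded), and let $p$ be an admissible weight on $I$: $p$ is $C^\infty$ and positive on $I$ except at finitely many points, and $\int_I p\,|u|\,dx < \infty$ for every polynomial $u$. Suppose that $L$ is self-adjoint with respect to $\langle u, v\rangle = \int_I p\,u\,v\,dx$, that is, $\langle Ly, u\rangle = \langle y, Lu\rangle$ for all $C^\infty$ functions $y, u : \mathbb{R} \to \mathbb{R}$ all of whose derivatives (including those of order $0$) have at most polynomial growth. Then for every real root $r$ of $a_n$, the multiplicity of $r$ as a root of $a_n$ is at least $2$, and the multiplicity of $r$ as a root of $a_{n-1}$ is positive and strictly smaller than its multiplicity as a root of $a_n$ (in particular $a_{n-1} \not\equiv 0$). -/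

import Mathlib

open Polynomial MeasureTheory
open scoped ContDiff

noncomputable section

/-- The differential operator `L = ∑_{k=1}^n a_k(x) D^k` with polynomial coefficients. -/
def polyDiffOp (n : ℕ) (a : ℕ → ℝ[X]) (y : ℝ → ℝ) (x : ℝ) : ℝ :=
  ∑ k ∈ Finset.Icc 1 n, (a k).eval x * iteratedDeriv k y x

/-- `L = ∑_{k=1}^n a_k(x) D^k` is of order `n` (its leading coefficient does not vanish
identically) and each `a_k` has degree at most `k`, so that `L` maps the polynomials of degree
at most `N` to themselves, for every `N`. -/
structure IsPolyDiffOpOfOrder (n : ℕ) (a : ℕ → ℝ[X]) : Prop where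
  leading_ne_zero : a n ≠ 0
  natDegree_le : ∀ k ∈ Finset.Icc 1 n, (a k).natDegree ≤ k

/-- An admissible weight on a set `I` (in use, a nondegenerate interval, bounded or not, with
or without its endpoints): positive and smooth off finitely many points of `I`, with all
polynomials integrable against it. No condition is put on `p` at the exceptional points or on the
limits of `p` there. -/
structure IsAdmissibleWeight (I : Set ℝ) (p : ℝ → ℝ) : Prop where
  piecewise_smooth_pos : ∃ S : Set ℝ, S.Finite ∧ ContDiffOn ℝ ∞ p (I \ S) ∧ ∀ x ∈ I \ S, 0 < p x
  integrable : ∀ u : ℝ[X], IntegrableOn (fun x => p x * u.eval x) I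

/-- The inner product `⟨u, v⟩ = ∫_I p u v dx`. -/
def weightedInner (I : Set ℝ) (p u v : ℝ → ℝ) : ℝ :=
  ∫ x in I, p x * u x * v x

/-- `L` is self-adjoint for `⟨u, v⟩ = ∫_I p u v dx`: `⟨L y, u⟩ = ⟨y, L u⟩` for smooth `y`, `u`.
The functions range over the smooth functions whose derivatives of all orders grow at most
polynomially; on these all the integrals converge for every admissible weight. They include the
polynomials and the compactly supported smooth functions, and for bounded `I` the growth
condition restricts nothing on `I`. -/
def IsSelfAdjointFor (n : ℕ) (a : ℕ → ℝ[X]) (I : Set ℝ) (p : ℝ → ℝ) : Prop :=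
  ∀ y u : ℝ → ℝ, Function.HasTemperateGrowth y → Function.HasTemperateGrowth u →
    weightedInner I p (polyDiffOp n a y) u = weightedInner I p y (polyDiffOp n a u)

end

open Filter Topology

/-! Testing self-adjointness on functions supported where `p` is smooth shows that the formal
adjoint of `L` applied to `p u` is `p L u`. Coefficientwise this is the system `∑_{j ≥ k} (-1)^j
C(j,k) (a_j p)^(j-k) = a_k p` (`determining_equation`). The equation `k = n` makes `n` even; then `k
= n - 1` reads `a_n p' = N p` with `N = (2/n) a_{n-1} - a_n'`. So `p'/p` is rational, and the order
of `a_{n-1}` at a point can be read off from `a_n` and `N`.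

The core is that `a_n` vanishes to order at least `n/2` at every finite endpoint of `I`, while `deg
a_n ≤ n/2` if `I` has an infinite end and `a_n` is constant if `I` is the whole line. As `deg a_n ≤
n`, no multiplicity is left for a root that is not an endpoint.

Two mechanisms give these bounds. Where `p'/p` grows faster than differentiation can raise orders,
the leading terms of the determining equations assemble into a polynomial `T` with `T(-(z + c)) =
T(z)`, which vanishes at `0` to at most half its degree (`symbol_bound`). At infinity, integrability
of all polynomials forbids `p'/p = O(1/x)`, so this always applies (`infinite_end`); at an irregular
finite endpoint it leaves only the multiplicities `n` and `n - 2` (`irregular_endpoint`).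

Where `p'/p` has at most a simple pole, `p ~ c x^s` with `s > -1`. Pairing `x^j` with `e^{-tx}` and
letting `t → ∞`, Watson's lemma turns self-adjointness into vanishing sums of Gamma values, that is,
into `d` roots of a nonzero polynomial of degree at most `n - d`, where `d` is the largest value of
`k - ord a_k`. Hence `n - ord a_n ≤ d ≤ n/2`, and `s > -1` makes the order of `a_{n-1}` exactly one
less than that of `a_n` (`regular_endpoint`). -/

/-! ### Polynomial test functions and integration by parts on an open set. -/

lemma iteratedDeriv_polynomial_eval (u : ℝ[X]) (k : ℕ) :
    iteratedDeriv k (fun x => u.eval x) = fun x => (derivative^[k] u).eval x := by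
  induction k generalizing u with
  | zero => simp
  | succ k ih =>
    have h : deriv (fun x => u.eval x) = fun x => (derivative u).eval x := by
      ext x; exact u.deriv
    rw [iteratedDeriv_succ', h, ih]
    simp

lemma polyDiffOp_eq_sum_range {n : ℕ} {a : ℕ → ℝ[X]} (h0 : a 0 = 0) (y : ℝ → ℝ) (x : ℝ) :
    polyDiffOp n a y x = ∑ k ∈ Finset.range (n + 1), (a k).eval x * iteratedDeriv k y x := by
  rw [polyDiffOp, Finset.range_eq_Ico, Finset.sum_eq_sum_Ico_succ_bot (by omega)]
  simp only [h0, eval_zero, zero_mul, zero_add]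
  rfl

lemma polyDiffOp_polynomial {n : ℕ} {a : ℕ → ℝ[X]} (h0 : a 0 = 0) (u : ℝ[X]) (x : ℝ) :
    polyDiffOp n a (fun x => u.eval x) x =
      (∑ k ∈ Finset.range (n + 1), a k * derivative^[k] u).eval x := by
  rw [polyDiffOp_eq_sum_range h0, eval_finsetSum]
  simp [iteratedDeriv_polynomial_eval]

lemma hasTemperateGrowth_polynomial (u : ℝ[X]) :
    Function.HasTemperateGrowth (fun x : ℝ => u.eval x) := by
  simp only [eval_eq_sum_range]
  fun_prop

lemma contDiff_polynomial_eval (u : ℝ[X]) {m : WithTop ℕ∞} :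
    ContDiff ℝ m (fun x : ℝ => u.eval x) := by
  simp only [eval_eq_sum_range]
  fun_prop

lemma contDiffOn_iteratedDeriv {U : Set ℝ} (hU : IsOpen U) {F : ℝ → ℝ}
    (hF : ContDiffOn ℝ ∞ F U) (k : ℕ) : ContDiffOn ℝ ∞ (iteratedDeriv k F) U := by
  induction k with
  | zero => simpa
  | succ k ih =>
    rw [iteratedDeriv_succ]
    exact ih.deriv_of_isOpen hU (by simp)

lemma tsupport_iteratedDeriv_subset (y : ℝ → ℝ) (k : ℕ) :
    tsupport (iteratedDeriv k y) ⊆ tsupport y := by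
  induction k with
  | zero => simp
  | succ k ih =>
    rw [iteratedDeriv_succ]
    exact (closure_minimal (support_deriv_subset) (isClosed_tsupport _)).trans ih

lemma continuous_mul_of_tsupport_subset {U : Set ℝ} (hU : IsOpen U) {F y : ℝ → ℝ}
    (hF : ContinuousOn F U) (hy : Continuous y) (hyU : tsupport y ⊆ U) :
    Continuous fun x => F x * y x := by
  refine continuous_iff_continuousAt.2 fun x => ?_
  by_cases hx : x ∈ tsupport y
  · exact (hF.continuousAt (hU.mem_nhds (hyU hx))).mul hy.continuousAt
  · have : (fun x => F x * y x) =ᶠ[𝓝 x] fun _ => 0 := by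
      filter_upwards [(isClosed_tsupport y).isOpen_compl.mem_nhds hx] with z hz
      rw [image_eq_zero_of_notMem_tsupport hz, mul_zero]
    exact this.continuousAt

lemma integrable_mul_of_tsupport_subset {U : Set ℝ} (hU : IsOpen U) {F y : ℝ → ℝ}
    (hF : ContinuousOn F U) (hy : Continuous y) (hc : HasCompactSupport y)
    (hyU : tsupport y ⊆ U) : Integrable fun x => F x * y x :=
  (continuous_mul_of_tsupport_subset hU hF hy hyU).integrable_of_hasCompactSupport hc.mul_left

/-- Nothing is known of `F` off `U`, but `F y` vanishes near every point outside the support of `y`,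
so it is differentiable everywhere and its derivative integrates to zero. -/
lemma integral_mul_deriv_of_tsupport_subset {U : Set ℝ} (hU : IsOpen U) {F y : ℝ → ℝ}
    (hF : ContDiffOn ℝ ∞ F U) (hy : ContDiff ℝ ∞ y) (hc : HasCompactSupport y)
    (hyU : tsupport y ⊆ U) : ∫ x, F x * deriv y x = - ∫ x, deriv F x * y x := by
  have hF' : ContDiffOn ℝ ∞ (deriv F) U := hF.deriv_of_isOpen hU (by simp)
  have hy' : ContDiff ℝ ∞ (deriv y) := (contDiff_infty_iff_deriv.1 hy).2
  have hsub : tsupport (deriv y) ⊆ tsupport y := by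
    simpa using tsupport_iteratedDeriv_subset y 1
  have i1 := integrable_mul_of_tsupport_subset hU hF.continuousOn hy'.continuous hc.deriv
    (hsub.trans hyU)
  have i2 := integrable_mul_of_tsupport_subset hU hF'.continuousOn hy.continuous hc hyU
  have i3 := integrable_mul_of_tsupport_subset hU hF.continuousOn hy.continuous hc hyU
  have key : ∫ x, (deriv F x * y x + F x * deriv y x) = 0 := by
    refine integral_eq_zero_of_hasDerivAt_of_integrable (f := fun x => F x * y x) (fun x => ?_)
      (i2.add i1) i3
    by_cases hx : x ∈ tsupport y
    · exact (((hF.contDiffAt (hU.mem_nhds (hyU hx))).differentiableAt (by simp)).hasDerivAt).mul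
        ((hy.differentiable (by simp)).differentiableAt.hasDerivAt)
    · have h0 : (fun x => F x * y x) =ᶠ[𝓝 x] fun _ => 0 := by
        filter_upwards [(isClosed_tsupport y).isOpen_compl.mem_nhds hx] with z hz
        rw [image_eq_zero_of_notMem_tsupport hz, mul_zero]
      rw [image_eq_zero_of_notMem_tsupport hx,
        image_eq_zero_of_notMem_tsupport (fun h => hx (hsub h))]
      simpa using (hasDerivAt_const x (0 : ℝ)).congr_of_eventuallyEq h0
  rw [integral_add i2 i1] at key
  linarith

lemma integral_mul_iteratedDeriv_of_tsupport_subset {U : Set ℝ} (hU : IsOpen U) {F y : ℝ → ℝ}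
    (hF : ContDiffOn ℝ ∞ F U) (hy : ContDiff ℝ ∞ y) (hc : HasCompactSupport y)
    (hyU : tsupport y ⊆ U) (k : ℕ) :
    ∫ x, F x * iteratedDeriv k y x = (-1) ^ k * ∫ x, iteratedDeriv k F x * y x := by
  induction k generalizing F with
  | zero => simp
  | succ k ih =>
    have hk : ContDiff ℝ ∞ (iteratedDeriv k y) := by
      exact contDiffOn_univ.1 (contDiffOn_iteratedDeriv isOpen_univ hy.contDiffOn k)
    have hck : HasCompactSupport (iteratedDeriv k y) :=
      hc.of_isClosed_subset (isClosed_tsupport _) (tsupport_iteratedDeriv_subset y k)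
    rw [iteratedDeriv_succ, integral_mul_deriv_of_tsupport_subset hU hF hk hck
      ((tsupport_iteratedDeriv_subset y k).trans hyU),
      ih (hF.deriv_of_isOpen hU (by simp)), iteratedDeriv_succ', pow_succ]
    ring

/-! ### The formal adjoint and the determining equations. -/

/-- The formal adjoint of a self-adjoint operator, applied to `p u`, is `p L u`. -/
lemma formalAdjoint_eq {n : ℕ} {a : ℕ → ℝ[X]} (h0 : a 0 = 0) {I : Set ℝ} {p : ℝ → ℝ}
    (hsa : IsSelfAdjointFor n a I p) {U : Set ℝ} (hU : IsOpen U) (hUI : U ⊆ I)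
    (hp : ContDiffOn ℝ ∞ p U) (u : ℝ[X]) {x : ℝ} (hx : x ∈ U) :
    ∑ k ∈ Finset.range (n + 1), (-1) ^ k *
        iteratedDeriv k (fun z => ((a k).eval z * p z) * u.eval z) x =
      ∑ k ∈ Finset.range (n + 1), (a k).eval x * p x * (derivative^[k] u).eval x := by
  have hF : ∀ k, ContDiffOn ℝ ∞ (fun z => ((a k).eval z * p z) * u.eval z) U := fun k =>
    ((contDiff_polynomial_eval _).contDiffOn.mul hp).mul (contDiff_polynomial_eval u).contDiffOn
  set G : ℝ → ℝ := fun x => ∑ k ∈ Finset.range (n + 1), (-1) ^ k *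
        iteratedDeriv k (fun z => ((a k).eval z * p z) * u.eval z) x with hG
  set H : ℝ → ℝ := fun x =>
    ∑ k ∈ Finset.range (n + 1), (a k).eval x * p x * (derivative^[k] u).eval x with hH
  have hGc : ContinuousOn G U := continuousOn_finsetSum _ fun k _ =>
    continuousOn_const.mul (contDiffOn_iteratedDeriv hU (hF k) k).continuousOn
  have hHc : ContinuousOn H U := continuousOn_finsetSum _ fun k _ =>
    ((a k).continuous.continuousOn.mul hp.continuousOn).mul
      (Polynomial.continuous _).continuousOn
  -- Fundamental lemma of the calculus of variations: `y` runs over bumps supported in `U`, and all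
  -- derivatives are moved from `y` onto `p u`. Continuity then upgrades the almost everywhere
  -- equality to every point of `U`.
  have hae : ∀ᵐ x, x ∈ U → (fun x => G x - H x) x = 0 := by
    refine hU.ae_eq_zero_of_integral_contDiff_smul_eq_zero
      ((hGc.sub hHc).locallyIntegrableOn hU.measurableSet) fun y hy hc hyU => ?_
    have hyt : Function.HasTemperateGrowth y := (hc.toSchwartzMap hy).hasTemperateGrowth
    have hk : ∀ k, ContDiff ℝ ∞ (iteratedDeriv k y) := fun k => by
      exact contDiffOn_univ.1 (contDiffOn_iteratedDeriv isOpen_univ hy.contDiffOn k)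
    have hck : ∀ k, HasCompactSupport (iteratedDeriv k y) := fun k =>
      hc.of_isClosed_subset (isClosed_tsupport _) (tsupport_iteratedDeriv_subset y k)
    have h := hsa y (fun x => u.eval x) hyt (hasTemperateGrowth_polynomial u)
    have e1 : weightedInner I p (polyDiffOp n a y) (fun x => u.eval x) = ∫ x, G x * y x := by
      have : ∀ x, p x * polyDiffOp n a y x * u.eval x = ∑ k ∈ Finset.range (n + 1),
          (((a k).eval x * p x) * u.eval x) * iteratedDeriv k y x := fun x => by
        rw [polyDiffOp_eq_sum_range h0, Finset.mul_sum, Finset.sum_mul]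
        exact Finset.sum_congr rfl fun k _ => by ring
      rw [weightedInner, setIntegral_eq_integral_of_forall_compl_eq_zero]
      · simp_rw [this]
        rw [integral_finsetSum]
        · simp_rw [integral_mul_iteratedDeriv_of_tsupport_subset hU (hF _) hy hc hyU, hG,
            Finset.sum_mul]
          rw [integral_finsetSum]
          · refine Finset.sum_congr rfl fun k _ => ?_
            simp_rw [mul_assoc]
            rw [integral_const_mul]
          · intro k _
            exact ((integrable_mul_of_tsupport_subset hU
              (contDiffOn_iteratedDeriv hU (hF k) k).continuousOn hy.continuous hc
              hyU).const_mul ((-1) ^ k)).congr (Eventually.of_forall fun x => by ring)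
        · intro k _
          exact integrable_mul_of_tsupport_subset hU (hF k).continuousOn (hk k).continuous
            (hck k) ((tsupport_iteratedDeriv_subset y k).trans hyU)
      · intro x hx
        rw [this]
        refine Finset.sum_eq_zero fun k _ => ?_
        rw [image_eq_zero_of_notMem_tsupport
          (fun h => hx (hUI (hyU (tsupport_iteratedDeriv_subset y k h)))), mul_zero]
    have e2 : weightedInner I p y (polyDiffOp n a fun x => u.eval x) = ∫ x, H x * y x := by
      rw [weightedInner, setIntegral_eq_integral_of_forall_compl_eq_zero]
      · refine integral_congr_ae (Eventually.of_forall fun x => ?_)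
        simp only [hH]
        rw [polyDiffOp_polynomial h0, eval_finsetSum, Finset.mul_sum, Finset.sum_mul]
        exact Finset.sum_congr rfl fun k _ => by rw [eval_mul]; ring
      · intro x hx
        rw [image_eq_zero_of_notMem_tsupport (fun h => hx (hUI (hyU h)))]; ring
    rw [e1, e2] at h
    have i1 := integrable_mul_of_tsupport_subset hU hGc hy.continuous hc hyU
    have i2 := integrable_mul_of_tsupport_subset hU hHc hy.continuous hc hyU
    have : (fun x => y x • (G x - H x)) = fun x => G x * y x - H x * y x := by
      ext x; simp; ring
    rw [this, integral_sub i1 i2, h, sub_self]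
  have := Measure.eqOn_open_of_ae_eq (μ := volume) (f := fun x => G x - H x) (g := fun _ => 0)
    ((ae_restrict_iff' hU.measurableSet).2 hae) hU (hGc.sub hHc) continuousOn_const hx
  exact sub_eq_zero.1 this

lemma eval_iterate_derivative_X_sub_C_pow (x : ℝ) (m k : ℕ) :
    (derivative^[k] ((X - C x) ^ m)).eval x = if k = m then (m.factorial : ℝ) else 0 := by
  rw [iterate_derivative_X_sub_pow]
  rcases lt_trichotomy k m with h | h | h
  · simp [h.ne, zero_pow (Nat.sub_ne_zero_of_lt h)]
  · simp [h, Nat.descFactorial_self]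
  · simp [h.ne', Nat.descFactorial_eq_zero_iff_lt.2 h]

/-- The determining equations of a self-adjoint operator. -/
lemma determining_equation {n : ℕ} {a : ℕ → ℝ[X]} (h0 : a 0 = 0) {I : Set ℝ} {p : ℝ → ℝ}
    (hsa : IsSelfAdjointFor n a I p) {U : Set ℝ} (hU : IsOpen U) (hUI : U ⊆ I)
    (hp : ContDiffOn ℝ ∞ p U) {x : ℝ} (hx : x ∈ U) {k : ℕ} (hk : k ≤ n) :
    ∑ j ∈ Finset.Icc k n, (-1) ^ j * (j.choose k : ℝ) *
        iteratedDeriv (j - k) (fun z => (a j).eval z * p z) x = (a k).eval x * p x := by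
  -- At the point `x` only the `k`-th derivative of `(X - x)^k` survives, which isolates the `k`-th
  -- equation up to the factor `k!`.
  have h := formalAdjoint_eq h0 hsa hU hUI hp ((X - C x) ^ k) hx
  have hx' : ContDiffAt ℝ ∞ p x := hp.contDiffAt (hU.mem_nhds hx)
  have e : ∀ j, iteratedDeriv j (fun z => ((a j).eval z * p z) * ((X - C x) ^ k).eval z) x =
      if k ≤ j then (j.choose k : ℝ) * iteratedDeriv (j - k) (fun z => (a j).eval z * p z) x *
        k.factorial else 0 := fun j => by
    have hA : ContDiffAt ℝ j (fun z => (a j).eval z * p z) x :=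
      ((contDiff_polynomial_eval (a j)).contDiffAt.mul hx').of_le (by exact_mod_cast le_top)
    simp_rw [mul_comm _ (((X - C x) ^ k).eval _)]
    rw [iteratedDeriv_fun_mul (contDiff_polynomial_eval _).contDiffAt hA]
    simp only [iteratedDeriv_polynomial_eval, eval_iterate_derivative_X_sub_C_pow]
    simp only [mul_ite, mul_zero, ite_mul, zero_mul, Finset.sum_ite_eq', Finset.mem_range]
    by_cases hkj : k ≤ j
    · rw [if_pos (by omega), if_pos hkj]; ring
    · rw [if_neg (by omega), if_neg hkj]
  simp only [e, eval_iterate_derivative_X_sub_C_pow, mul_ite, mul_zero, Finset.sum_ite_eq',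
    Finset.mem_range] at h
  rw [if_pos (by omega), ← Finset.sum_filter] at h
  have hs : (Finset.range (n + 1)).filter (fun j => k ≤ j) = Finset.Icc k n := by
    ext j; simp; omega
  rw [hs] at h
  have hf : (k.factorial : ℝ) ≠ 0 := by exact_mod_cast k.factorial_ne_zero
  refine mul_right_cancel₀ hf ?_
  rw [← h, Finset.sum_mul]
  exact Finset.sum_congr rfl fun j _ => by ring

/-! ### Orders of growth of polynomials at a place. -/

/-- `f` is asymptotic to `c φ ^ e` along `l` (and `o(φ ^ e)` if `c = 0`). -/
def HasLevel (l : Filter ℝ) (φ : ℝ → ℝ) (e : ℤ) (f : ℝ[X]) (c : ℝ) : Prop :=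
  Tendsto (fun x => f.eval x * φ x ^ (-e)) l (𝓝 c)

/-- A place of the projective line, seen through a filter `l` and a large parameter `φ`: nonzero
polynomials have an exact order in `φ`, and differentiation raises the order by at most `τ`. -/
structure IsPlace (l : Filter ℝ) (φ : ℝ → ℝ) (τ : ℤ) : Prop where
  tendsto : Tendsto φ l atTop
  exists_level : ∀ f : ℝ[X], f ≠ 0 → ∃ e c, c ≠ 0 ∧ HasLevel l φ e f c
  derivative : ∀ (f : ℝ[X]) (e : ℤ) (c : ℝ), HasLevel l φ e f c →
    ∃ c', HasLevel l φ (e + τ) (derivative f) c'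

lemma tendsto_zpow_neg_zero {l : Filter ℝ} {φ : ℝ → ℝ} (hφ : Tendsto φ l atTop) {m : ℤ}
    (hm : 0 < m) : Tendsto (fun x => φ x ^ (-m)) l (𝓝 0) :=
  (tendsto_zpow_atTop_zero (𝕜 := ℝ) (n := -m) (by omega)).comp hφ

lemma HasLevel.of_lt {l : Filter ℝ} {φ : ℝ → ℝ} (hφ : Tendsto φ l atTop) {e e' : ℤ} {f : ℝ[X]}
    {c : ℝ} (h : HasLevel l φ e f c) (hlt : e < e') : HasLevel l φ e' f 0 := by
  have h1 := h.mul (tendsto_zpow_neg_zero hφ (sub_pos.2 hlt))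
  rw [mul_zero] at h1
  refine h1.congr' ?_
  filter_upwards [hφ.eventually_gt_atTop 0] with x hx
  rw [mul_assoc, ← zpow_add₀ hx.ne']
  congr 2; ring

lemma HasLevel.le {l : Filter ℝ} [l.NeBot] {φ : ℝ → ℝ} (hφ : Tendsto φ l atTop) {e e' : ℤ}
    {f : ℝ[X]} {c c' : ℝ} (h : HasLevel l φ e f c) (hc : c ≠ 0) (h' : HasLevel l φ e' f c') :
    e ≤ e' := by
  by_contra! hlt
  exact hc (tendsto_nhds_unique h (h'.of_lt hφ hlt))

lemma HasLevel.mono {l : Filter ℝ} {φ : ℝ → ℝ} (hφ : Tendsto φ l atTop) {e e' : ℤ} {f : ℝ[X]}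
    {c : ℝ} (h : HasLevel l φ e f c) (hle : e ≤ e') : ∃ c', HasLevel l φ e' f c' := by
  rcases hle.eq_or_lt with rfl | hlt
  · exact ⟨c, h⟩
  · exact ⟨0, h.of_lt hφ hlt⟩

lemma HasLevel.mul {l : Filter ℝ} {φ : ℝ → ℝ} (hφ : Tendsto φ l atTop) {e e' : ℤ} {f g : ℝ[X]}
    {c c' : ℝ} (h : HasLevel l φ e f c) (h' : HasLevel l φ e' g c') :
    HasLevel l φ (e + e') (f * g) (c * c') := by
  refine (Tendsto.mul h h').congr' ?_
  filter_upwards [hφ.eventually_gt_atTop 0] with x hx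
  rw [eval_mul, neg_add, zpow_add₀ hx.ne']; ring

lemma HasLevel.add {l : Filter ℝ} {φ : ℝ → ℝ} {e : ℤ} {f g : ℝ[X]}
    {c c' : ℝ} (h : HasLevel l φ e f c) (h' : HasLevel l φ e g c') :
    HasLevel l φ e (f + g) (c + c') := by
  refine (Tendsto.add h h').congr fun x => ?_
  rw [eval_add]; ring

lemma HasLevel.const_mul {l : Filter ℝ} {φ : ℝ → ℝ} {e : ℤ} {f : ℝ[X]}
    {c : ℝ} (h : HasLevel l φ e f c) (r : ℝ) : HasLevel l φ e (C r * f) (r * c) := by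
  refine (Tendsto.const_mul r h).congr fun x => ?_
  rw [eval_mul, eval_C]; ring

lemma IsPlace.iterate_derivative {l : Filter ℝ} {φ : ℝ → ℝ} {τ : ℤ} (hP : IsPlace l φ τ)
    {f : ℝ[X]} {e : ℤ} {c : ℝ} (h : HasLevel l φ e f c) (r : ℕ) :
    ∃ c', HasLevel l φ (e + r * τ) (Polynomial.derivative^[r] f) c' := by
  induction r with
  | zero => exact ⟨c, by simpa using h⟩
  | succ r ih =>
    obtain ⟨c', h'⟩ := ih
    obtain ⟨c'', h''⟩ := hP.derivative _ _ _ h'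
    refine ⟨c'', ?_⟩
    rw [Function.iterate_succ_apply']
    convert h'' using 1
    push_cast; ring

/-! ### The symmetric principal symbol. -/

/-- A polynomial invariant under `z ↦ -(z + c)` vanishes to at most half its degree at `0`. -/
lemma two_mul_natTrailingDegree_le {T : ℝ[X]} (hT : T ≠ 0) {c : ℝ} (hc : c ≠ 0)
    (h : T.comp (-(X + C c)) = T) : 2 * T.natTrailingDegree ≤ T.natDegree := by
  set j := T.natTrailingDegree
  have h1 : (X : ℝ[X]) ^ j ∣ T := X_pow_dvd_iff.2 fun d hd =>
    coeff_eq_zero_of_lt_natTrailingDegree hd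
  -- The symmetry exchanges `0` and `-c`, so `T` vanishes to the same order at both; these points
  -- differ because `c ≠ 0`.
  have h2 : (X + C c) ^ j ∣ T := by
    obtain ⟨g, hg⟩ := h1
    have : T = (-(X + C c)) ^ j * g.comp (-(X + C c)) := by
      conv_lhs => rw [← h, hg]
      simp
    rw [this, neg_pow]
    exact ⟨(-1) ^ j * g.comp (-(X + C c)), by ring⟩
  have hcop : IsCoprime (X : ℝ[X]) (X + C c) := by
    refine ⟨-C c⁻¹, C c⁻¹, ?_⟩
    have : C c⁻¹ * C c = (1 : ℝ[X]) := by rw [← C_mul, inv_mul_cancel₀ hc, C_1]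
    linear_combination this
  have h3 := natDegree_le_of_dvd ((hcop.pow (m := j) (n := j)).mul_dvd h1 h2) hT
  rw [natDegree_mul (pow_ne_zero _ X_ne_zero) (pow_ne_zero _ (X_add_C_ne_zero c)), natDegree_pow,
    natDegree_pow, natDegree_X, natDegree_X_add_C] at h3
  omega

/-- Comparison of principal symbols at a place where `p ^ (i) / p ~ (c φ ^ κ) ^ i`. -/
lemma symbol_bound {l : Filter ℝ} [l.NeBot] {φ : ℝ → ℝ} {τ κ β : ℤ} (hP : IsPlace l φ τ)
    (hκ : τ < κ) (hβ : 0 ≤ β + κ) {n : ℕ} {a : ℕ → ℝ[X]} {Q : ℕ → ℝ → ℝ} {c : ℝ} (hc : c ≠ 0)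
    (hQ : ∀ i : ℕ, Tendsto (fun x => Q i x * φ x ^ (-(i * κ))) l (𝓝 (c ^ i)))
    (hbd : ∀ k ≤ n, ∃ c', HasLevel l φ (β * k) (a k) c')
    (hid : ∀ k ≤ n, ∀ᶠ x in l, ∑ j ∈ Finset.Icc k n, (-1) ^ j * (j.choose k : ℝ) *
      ∑ i ∈ Finset.range (j - k + 1), ((j - k).choose i : ℝ) * Q i x *
        (derivative^[j - k - i] (a j)).eval x = (a k).eval x)
    {e : ℤ} {α : ℝ} (hα : α ≠ 0) (hlead : HasLevel l φ e (a n) α) :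
    2 * (e + n * κ) ≤ n * (β + κ) := by
  have hφ := hP.tendsto
  have han : a n ≠ 0 := by
    intro h
    have : HasLevel l φ e (a n) 0 := by simp [HasLevel, h]
    exact hα (tendsto_nhds_unique hlead this)
  -- `M` is the largest value of `ord a_k + k κ`: the weighted order in which each derivative counts
  -- `κ`, as it does when it falls on `p`. The limits at this level are the coefficients of the
  -- symbol `T`, and `k₀` attains the maximum, so `T ≠ 0`.
  obtain ⟨M, hM, k₀, hk₀, t₀, ht₀, hlev₀⟩ : ∃ M : ℤ,
      (∀ k, ∃ t, k ≤ n → HasLevel l φ (M - k * κ) (a k) t) ∧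
      ∃ k ≤ n, ∃ t, t ≠ 0 ∧ HasLevel l φ (M - k * κ) (a k) t := by
    choose! E γ hγ hE using hP.exists_level
    obtain ⟨k₀, hk₀, hmax⟩ := Finset.exists_max_image
      ((Finset.range (n + 1)).filter fun k => a k ≠ 0) (fun k => E (a k) + k * κ)
      ⟨n, by simp [han]⟩
    simp only [Finset.mem_filter, Finset.mem_range] at hk₀ hmax
    refine ⟨E (a k₀) + k₀ * κ, fun k => ?_, k₀, by omega, γ (a k₀), hγ _ hk₀.2, ?_⟩
    · by_cases hk : a k = 0
      · exact ⟨0, fun _ => by simp [HasLevel, hk]⟩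
      · by_cases hkn : k ≤ n
        · obtain ⟨t, ht⟩ := (hE _ hk).mono hφ
            (show E (a k) ≤ E (a k₀) + k₀ * κ - k * κ by
              have := hmax k ⟨by omega, hk⟩
              linarith)
          exact ⟨t, fun _ => ht⟩
        · exact ⟨0, fun h => absurd h hkn⟩
    · simpa using hE _ hk₀.2
  choose t ht using hM
  have hrec : ∀ k ≤ n, ∑ j ∈ Finset.Icc k n, (-1) ^ j * (j.choose k : ℝ) *
      (t j * c ^ (j - k)) = t k := by
    intro k hk
    refine tendsto_nhds_unique (f := fun x => (a k).eval x * φ x ^ (-(M - k * κ))) (l := l) ?_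
      (ht k hk)
    refine Tendsto.congr' (f₁ := fun x => ∑ j ∈ Finset.Icc k n, (-1) ^ j * (j.choose k : ℝ) *
      ∑ i ∈ Finset.range (j - k + 1), (((j - k).choose i : ℝ) * (Q i x *
        (derivative^[j - k - i] (a j)).eval x * φ x ^ (-(M - k * κ))))) ?_ ?_
    · filter_upwards [hid k hk] with x hx
      rw [← hx, Finset.sum_mul]
      refine Finset.sum_congr rfl fun j _ => ?_
      rw [mul_assoc _ _ (φ x ^ _), Finset.sum_mul]
      congr 1
      exact Finset.sum_congr rfl fun i _ => by ring
    · refine tendsto_finsetSum _ fun j hj => Tendsto.const_mul _ ?_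
      rw [Finset.mem_Icc] at hj
      -- Each derivative falling on `a_j` instead of `p` costs at least a factor `φ ^ (κ - τ)`, so
      -- only the term with all of them on `p` survives.
      have hterm : ∀ i ∈ Finset.range (j - k + 1), Tendsto (fun x => ((j - k).choose i : ℝ) *
          (Q i x * (derivative^[j - k - i] (a j)).eval x * φ x ^ (-(M - k * κ)))) l
          (𝓝 (if i = j - k then t j * c ^ (j - k) else 0)) := by
        intro i hi
        rw [Finset.mem_range] at hi
        split_ifs with h
        · subst h
          simp only [Nat.choose_self, Nat.cast_one, one_mul, Nat.sub_self,
            Function.iterate_zero, id]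
          refine (Tendsto.mul (ht j hj.2) (hQ (j - k))).congr' ?_
          filter_upwards [hφ.eventually_gt_atTop 0] with x hx
          rw [mul_mul_mul_comm, ← zpow_add₀ hx.ne', mul_comm ((a j).eval x)]
          congr 2
          push_cast [hj.1]
          ring
        · obtain ⟨r, hr⟩ : ∃ r, j - k - i = r + 1 := ⟨j - k - i - 1, by omega⟩
          obtain ⟨c', hc'⟩ := hP.iterate_derivative (ht j hj.2) (r + 1)
          rw [hr]
          have hpos : 0 < ((r + 1 : ℕ) : ℤ) * (κ - τ) := by
            have : 0 < κ - τ := by linarith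
            positivity
          have := (((hQ i).mul hc').mul (tendsto_zpow_neg_zero hφ hpos)).const_mul
            ((j - k).choose i : ℝ)
          simp only [mul_zero] at this
          refine this.congr' ?_
          filter_upwards [hφ.eventually_gt_atTop 0] with x hx
          rw [mul_mul_mul_comm, mul_assoc (Q i x * _), ← zpow_add₀ hx.ne', ← zpow_add₀ hx.ne']
          congr 3
          have hji : (j : ℤ) = k + i + (r + 1) := by omega
          rw [hji]
          push_cast
          ring
      have := tendsto_finsetSum _ hterm
      rwa [Finset.sum_ite_eq' , if_pos (by simp)] at this
  set T : ℝ[X] := ∑ j ∈ Finset.range (n + 1), C (t j) * X ^ j with hTdef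
  have hcoeff : ∀ k ≤ n, T.coeff k = t k := fun k hk => by
    simp only [hTdef, finsetSum_coeff, coeff_C_mul, coeff_X_pow, mul_ite, mul_one, mul_zero,
      Finset.sum_ite_eq, Finset.mem_range]
    rw [if_pos (by omega)]
  have hdeg : T.natDegree ≤ n := natDegree_sum_le_of_forall_le _ _ fun j hj =>
    (natDegree_C_mul_X_pow_le _ _).trans (by simpa [Nat.lt_succ_iff] using hj)
  have hT : T ≠ 0 := by
    intro h
    have h1 := tendsto_nhds_unique hlev₀ (ht k₀ hk₀)
    rw [← hcoeff k₀ hk₀, h, coeff_zero] at h1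
    exact ht₀ h1
  -- Expanding `(X + c)^j` by the binomial theorem, the coefficients of this identity are exactly
  -- `hrec`.
  have hcomp : T.comp (-(X + C c)) = T := by
    have e1 : T.comp (-(X + C c)) =
        ∑ j ∈ Finset.range (n + 1), C (t j * (-1) ^ j) * (X + C c) ^ j := by
      simp only [hTdef, Polynomial.sum_comp, mul_comp, C_comp, X_pow_comp]
      refine Finset.sum_congr rfl fun j _ => ?_
      rw [neg_pow, C_mul, C_pow, C_neg, C_1]; ring
    ext k
    rw [e1, finsetSum_coeff]
    simp only [coeff_C_mul, coeff_X_add_C_pow]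
    by_cases hk : k ≤ n
    · rw [hcoeff k hk, ← hrec k hk]
      symm
      refine Finset.sum_subset_zero_on_sdiff (fun j hj => ?_) (fun j hj => ?_) (fun j _ => ?_)
      · simp only [Finset.mem_Icc] at hj; simp; omega
      · simp only [Finset.mem_sdiff, Finset.mem_range, Finset.mem_Icc] at hj
        rw [Nat.choose_eq_zero_of_lt (by omega)]; simp
      · ring
    · rw [coeff_eq_zero_of_natDegree_lt (by omega)]
      refine Finset.sum_eq_zero fun j hj => ?_
      rw [Finset.mem_range] at hj
      rw [Nat.choose_eq_zero_of_lt (by omega)]; simp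
  have h2 := two_mul_natTrailingDegree_le hT hc hcomp
  set j := T.natTrailingDegree with hj
  have hjn : j ≤ n := by omega
  have htj : t j ≠ 0 := by
    rw [← hcoeff j hjn]
    -- At the trailing degree `j ≤ n/2` of `T` the order of `a_j` is exactly `M - j κ`, and at most
    -- `β j`. Hence `e + n κ ≤ M ≤ j (β + κ)`, and `0 ≤ β + κ` lets `j` be replaced by `n/2`.
    exact trailingCoeff_nonzero_iff_nonzero.2 hT
  obtain ⟨c', hc'⟩ := hbd j hjn
  have i1 := (ht j hjn).le hφ htj hc'
  have i2 := hlead.le hφ hα (ht n le_rfl)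
  have i3 : (2 * j : ℤ) ≤ n := by exact_mod_cast h2.trans hdeg
  nlinarith

/-! ### The two places: infinity, and zero from the right. -/

lemma hasLevel_atTop (f : ℝ[X]) : HasLevel atTop id f.natDegree f f.leadingCoeff := by
  by_cases hf : f = 0
  · simp [HasLevel, hf]
  have h := div_tendsto_atTop_leadingCoeff_div_of_degree_eq f (X ^ f.natDegree)
    (by rw [degree_X_pow, degree_eq_natDegree hf])
  simp only [leadingCoeff_X_pow, div_one, eval_pow, eval_X] at h
  exact h.congr fun x => by simp [div_eq_mul_inv]

lemma isPlace_atTop : IsPlace atTop id (-1) where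
  tendsto := tendsto_id
  exists_level f hf := ⟨_, _, leadingCoeff_ne_zero.2 hf, hasLevel_atTop f⟩
  derivative f e c h := by
    by_cases hf : f.natDegree = 0
    · rw [eq_C_of_natDegree_eq_zero hf]
      exact ⟨0, by simp [HasLevel]⟩
    · have hf0 : f ≠ 0 := fun h => hf (by simp [h])
      have := (hasLevel_atTop f).le tendsto_id (leadingCoeff_ne_zero.2 hf0) h
      have := natDegree_derivative_le f
      exact (hasLevel_atTop (Polynomial.derivative f)).mono tendsto_id (by omega)

lemma hasLevel_zero {f : ℝ[X]} {m : ℕ} (h : X ^ m ∣ f) :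
    HasLevel (𝓝[>] 0) (fun x => x⁻¹) (-m) f (f.coeff m) := by
  obtain ⟨g, rfl⟩ := h
  have h1 : (X ^ m * g).coeff m = g.eval 0 := by
    rw [← coeff_zero_eq_eval_zero]; simpa using coeff_X_pow_mul g m 0
  rw [h1]
  have h2 : Tendsto (fun x => g.eval x) (𝓝[>] 0) (𝓝 (g.eval 0)) :=
    g.continuous.continuousAt.tendsto.mono_left nhdsWithin_le_nhds
  refine h2.congr' ?_
  filter_upwards [self_mem_nhdsWithin] with x hx
  have hx : (0 : ℝ) < x := hx
  rw [eval_mul, eval_pow, eval_X, neg_neg, zpow_natCast, inv_pow]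
  field_simp

lemma X_pow_natTrailingDegree_dvd (f : ℝ[X]) : X ^ f.natTrailingDegree ∣ f :=
  X_pow_dvd_iff.2 fun _ hd => coeff_eq_zero_of_lt_natTrailingDegree hd

lemma isPlace_zero : IsPlace (𝓝[>] 0) (fun x => x⁻¹) 1 where
  tendsto := tendsto_inv_nhdsGT_zero
  exists_level f hf := ⟨_, _, trailingCoeff_nonzero_iff_nonzero.2 hf,
    hasLevel_zero (X_pow_natTrailingDegree_dvd f)⟩
  derivative f e c h := by
    by_cases hf : f = 0
    · exact ⟨0, by simp [HasLevel, hf]⟩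
    have h1 := X_pow_natTrailingDegree_dvd f
    have h2 := (hasLevel_zero h1).le tendsto_inv_nhdsGT_zero
      (trailingCoeff_nonzero_iff_nonzero.2 hf) h
    have h3 : X ^ (f.natTrailingDegree - 1) ∣ Polynomial.derivative f := by
      obtain ⟨g, hg⟩ := h1
      generalize f.natTrailingDegree = m at hg
      rw [hg, derivative_mul, derivative_X_pow]
      refine dvd_add ⟨C (m : ℝ) * g, by ring⟩ ?_
      exact ((pow_dvd_pow X (Nat.sub_le m 1)).mul_right _)
    exact (hasLevel_zero h3).mono tendsto_inv_nhdsGT_zero (by omega)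

/-! ### The logarithmic derivative of the weight. -/

/-- The numerator of `p' / p` over the denominator `a n`, for a weight `p` making `L`
self-adjoint. -/
noncomputable def weightNum (n : ℕ) (a : ℕ → ℝ[X]) : ℝ[X] := C (2 / (n : ℝ)) * a (n - 1) - derivative (a n)

/-- The numerator of `p ^ (i) / p` over the denominator `A ^ i` if `p' / p = N / A`. -/
noncomputable def iterNum (A N : ℝ[X]) : ℕ → ℝ[X]
  | 0 => 1
  | i + 1 => A * derivative (iterNum A N i) - C (i : ℝ) * derivative A * iterNum A N i +
      N * iterNum A N i

/-- Differentiating the identity for `i` and multiplying by `A` gives the one for `i + 1`; no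
division is needed, so zeros of `A` in `U` do no harm. -/
lemma iteratedDeriv_mul_pow_eq_iterNum {U : Set ℝ} (hU : IsOpen U) {p : ℝ → ℝ}
    (hp : ContDiffOn ℝ ∞ p U) {A N : ℝ[X]}
    (hode : ∀ x ∈ U, A.eval x * deriv p x = N.eval x * p x) (i : ℕ) :
    ∀ x ∈ U, iteratedDeriv i p x * A.eval x ^ i = (iterNum A N i).eval x * p x := by
  induction i with
  | zero => intro x _; simp [iterNum]
  | succ i ih =>
    intro x hx
    have hpi := (((contDiffOn_iteratedDeriv hU hp i).contDiffAt (hU.mem_nhds hx)).differentiableAt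
      (by simp)).hasDerivAt
    have hp1 := ((hp.contDiffAt (hU.mem_nhds hx)).differentiableAt (by simp)).hasDerivAt
    have d1 := hpi.mul ((A.hasDerivAt x).pow i)
    have d2 := ((iterNum A N i).hasDerivAt x).mul hp1
    have heq : (iteratedDeriv i p * (fun x => A.eval x) ^ i) =ᶠ[𝓝 x]
        ((fun x => (iterNum A N i).eval x) * p) := by
      filter_upwards [hU.mem_nhds hx] with z hz using ih z hz
    have h := d1.unique (d2.congr_of_eventuallyEq heq)
    rw [← iteratedDeriv_succ] at h
    have h1 := ih x hx
    have h2 := hode x hx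
    have h3 : (i : ℝ) * A.eval x ^ (i - 1) * A.eval x = i * A.eval x ^ i := by
      rcases i with _ | i
      · simp
      · rw [Nat.add_sub_cancel, pow_succ]; ring
    simp only [iterNum, eval_add, eval_sub, eval_mul, eval_C, pow_succ]
    simp only [Pi.pow_apply] at h
    linear_combination A.eval x * h - iteratedDeriv i p x * (derivative A).eval x * h3
      + (iterNum A N i).eval x * h2 - i * (derivative A).eval x * h1

/-- Since `τ < κ`, the two terms of the recursion that contain a derivative have lower order than
the product with `N`, so `iterNum A N i` behaves like `N ^ i`. -/
lemma hasLevel_iterNum {l : Filter ℝ} {φ : ℝ → ℝ} {τ κ e : ℤ} (hP : IsPlace l φ τ)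
    (hκ : τ < κ) {A N : ℝ[X]} {α ν : ℝ} (hA : HasLevel l φ e A α)
    (hN : HasLevel l φ (e + κ) N ν) (i : ℕ) :
    HasLevel l φ (i * (e + κ)) (iterNum A N i) (ν ^ i) := by
  have hφ := hP.tendsto
  induction i with
  | zero => simpa [HasLevel, iterNum] using tendsto_const_nhds
  | succ i ih =>
    obtain ⟨c1, h1⟩ := hP.derivative _ _ _ ih
    obtain ⟨c2, h2⟩ := hP.derivative _ _ _ hA
    have k1 := (hA.mul hφ h1).of_lt hφ (show _ < ((i + 1 : ℕ) : ℤ) * (e + κ) by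
      push_cast; linarith)
    have k2 := ((h2.mul hφ ih).const_mul (-i)).of_lt hφ (show _ < ((i + 1 : ℕ) : ℤ) * (e + κ) by
      push_cast; linarith)
    have k3 := hN.mul hφ ih
    have e3 : e + κ + i * (e + κ) = ((i + 1 : ℕ) : ℤ) * (e + κ) := by push_cast; ring
    rw [e3] at k3
    convert (k1.add k2).add k3 using 1
    · simp only [iterNum, C_neg]; ring
    · ring

section Weight

variable {n : ℕ} {a : ℕ → ℝ[X]} {I : Set ℝ} {p : ℝ → ℝ} {U : Set ℝ}

lemma even_order (h0 : a 0 = 0) (hn : a n ≠ 0) (hsa : IsSelfAdjointFor n a I p) (hU : IsOpen U)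
    (hne : U.Nonempty) (hUI : U ⊆ I) (hp : ContDiffOn ℝ ∞ p U) (hpos : ∀ x ∈ U, 0 < p x) :
    Even n := by
  obtain ⟨x, hxU, hx⟩ : ∃ x ∈ U, (a n).eval x ≠ 0 := by
    by_contra! h
    refine hn (eq_zero_of_infinite_isRoot _ ?_)
    obtain ⟨x, hx⟩ := hne
    exact (infinite_of_mem_nhds x (hU.mem_nhds hx)).mono fun z hz => h z hz
  have h := determining_equation h0 hsa hU hUI hp hxU le_rfl
  simp only [Finset.Icc_self, Finset.sum_singleton, Nat.choose_self, Nat.cast_one, mul_one,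
    Nat.sub_self, iteratedDeriv_zero] at h
  by_contra hodd
  rw [Nat.not_even_iff_odd] at hodd
  rw [hodd.neg_one_pow] at h
  have := mul_ne_zero hx (hpos x hxU).ne'
  apply this; linarith

/-- This is the determining equation at `k = n - 1`: because `n` is even, the two copies of `a_{n-1}
p` add up instead of cancelling. -/
lemma weight_ode (h0 : a 0 = 0) (hn : a n ≠ 0) (hsa : IsSelfAdjointFor n a I p) (hU : IsOpen U)
    (hUI : U ⊆ I) (hp : ContDiffOn ℝ ∞ p U) (hpos : ∀ x ∈ U, 0 < p x) {x : ℝ} (hx : x ∈ U) :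
    (a n).eval x * deriv p x = (weightNum n a).eval x * p x := by
  have hev := even_order h0 hn hsa hU ⟨x, hx⟩ hUI hp hpos
  have hn0 : n ≠ 0 := fun h => hn (h ▸ h0)
  obtain ⟨m, rfl⟩ : ∃ m, n = m + 1 := ⟨n - 1, by omega⟩
  have h := determining_equation h0 hsa hU hUI hp hx (k := m) (by omega)
  have hodd : Odd m := by
    rw [Nat.even_add_one, Nat.not_even_iff_odd] at hev; exact hev
  have hI : Finset.Icc m (m + 1) = {m, m + 1} := by ext j; simp; omega
  have hd : deriv (fun z => (a (m + 1)).eval z * p z) x =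
      (derivative (a (m + 1))).eval x * p x + (a (m + 1)).eval x * deriv p x :=
    (((a (m + 1)).hasDerivAt x).mul
      ((hp.contDiffAt (hU.mem_nhds hx)).differentiableAt (by simp)).hasDerivAt).deriv
  rw [hI, Finset.sum_pair (by omega)] at h
  simp only [Nat.choose_self, Nat.cast_one, mul_one, Nat.sub_self, iteratedDeriv_zero,
    hodd.neg_one_pow, hev.neg_one_pow, Nat.choose_succ_self_right, Nat.add_sub_cancel_left,
    iteratedDeriv_one, hd] at h
  simp only [weightNum, eval_sub, eval_mul, eval_C, Nat.add_sub_cancel]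
  have hm : ((m + 1 : ℕ) : ℝ) ≠ 0 := by exact_mod_cast hn0
  field_simp
  linear_combination h

/-- `symbol_bound` with `Q i = p^(i) / p` and `c = ν / α`; the Leibniz rule splits the determining
equations into the required form. -/
lemma place_bound {l : Filter ℝ} [l.NeBot] {φ : ℝ → ℝ} {τ κ β e : ℤ} (hP : IsPlace l φ τ)
    (hκ : τ < κ) (hβ : 0 ≤ β + κ)
    (h0 : a 0 = 0) (hsa : IsSelfAdjointFor n a I p) (hU : IsOpen U)
    (hUI : U ⊆ I) (hp : ContDiffOn ℝ ∞ p U) (hpos : ∀ x ∈ U, 0 < p x) (hl : U ∈ l)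
    (hbd : ∀ k ≤ n, ∃ c', HasLevel l φ (β * k) (a k) c')
    {α ν : ℝ} (hα : α ≠ 0) (hν : ν ≠ 0) (hA : HasLevel l φ e (a n) α)
    (hN : HasLevel l φ (e + κ) (weightNum n a) ν) : 2 * (e + n * κ) ≤ n * (β + κ) := by
  have hφ := hP.tendsto
  have hn : a n ≠ 0 := by
    intro h
    have : HasLevel l φ e (a n) 0 := by simp [HasLevel, h]
    exact hα (tendsto_nhds_unique hA this)
  have hne : ∀ᶠ x in l, (a n).eval x ≠ 0 := by
    filter_upwards [Tendsto.eventually_ne hA hα] with x hx h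
    simp [h] at hx
  refine symbol_bound hP hκ hβ (Q := fun i x => iteratedDeriv i p x / p x)
    (div_ne_zero hν hα) (fun i => ?_) hbd (fun k hk => ?_) hα hA
  · have h1 := Tendsto.div (hasLevel_iterNum hP hκ hA hN i) (Tendsto.pow hA i) (pow_ne_zero i hα)
    rw [← div_pow] at h1
    refine h1.congr' ?_
    filter_upwards [hl, hne, hφ.eventually_gt_atTop 0] with x hxU hx hφx
    have h2 := iteratedDeriv_mul_pow_eq_iterNum hU hp
      (fun x hx => weight_ode h0 hn hsa hU hUI hp hpos hx) i x hxU
    have hpx := (hpos x hxU).ne'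
    have h3 : iteratedDeriv i p x / p x = (iterNum (a n) (weightNum n a) i).eval x /
        (a n).eval x ^ i := by
      rw [div_eq_div_iff hpx (pow_ne_zero _ hx), h2]
    rw [Pi.div_apply, h3, mul_pow, ← zpow_natCast (φ x ^ (-e)) i, ← zpow_mul, mul_div_mul_comm, div_eq_mul_inv
      (φ x ^ _), ← zpow_neg, ← zpow_add₀ hφx.ne']
    congr 2
    ring
  · filter_upwards [hl] with x hxU
    have hpx := (hpos x hxU).ne'
    have h := determining_equation h0 hsa hU hUI hp hxU hk
    have hx' : ContDiffAt ℝ ∞ p x := hp.contDiffAt (hU.mem_nhds hxU)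
    refine mul_right_cancel₀ hpx ?_
    rw [← h, Finset.sum_mul]
    refine Finset.sum_congr rfl fun j _ => ?_
    rw [mul_assoc _ _ (p x)]
    congr 1
    simp_rw [mul_comm _ (p _)]
    have hx'' : ContDiffAt ℝ ((j - k : ℕ) : WithTop ℕ∞) p x :=
      contDiffAt_infty.1 hx' (j - k)
    rw [iteratedDeriv_fun_mul hx''
      (contDiff_polynomial_eval _).contDiffAt, Finset.mul_sum]
    refine Finset.sum_congr rfl fun i _ => ?_
    rw [iteratedDeriv_polynomial_eval]
    field_simp

end Weight

/-! ### Infinite ends of the interval. -/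

/-- The condition says that `p x^K` is nondecreasing, so this positive function stays above a
positive constant on a half-line. -/
lemma not_integrableOn_mul_pow_of_deriv_nonneg {p : ℝ → ℝ} {R : ℝ} (hR : 0 < R)
    (hd : DifferentiableOn ℝ p (Set.Ioi R)) (hpos : ∀ x ∈ Set.Ioi R, 0 < p x) (K : ℕ)
    (h : ∀ x ∈ Set.Ioi R, 0 ≤ K * p x + x * deriv p x) :
    ¬ IntegrableOn (fun x => p x * x ^ K) (Set.Ioi R) := by
  intro hInt
  have hda : ∀ x ∈ Set.Ioi R, HasDerivAt (fun x => p x * x ^ K)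
      (deriv p x * x ^ K + p x * (K * x ^ (K - 1))) x := fun x hx =>
    ((hd.differentiableAt (Ioi_mem_nhds hx)).hasDerivAt).mul (hasDerivAt_pow K x)
  have hmono : MonotoneOn (fun x => p x * x ^ K) (Set.Ioi R) := by
    refine monotoneOn_of_deriv_nonneg (convex_Ioi R)
      (fun x hx => (hda x hx).continuousAt.continuousWithinAt)
      (fun x hx => (hda x (interior_subset hx)).differentiableAt.differentiableWithinAt)
      fun x hx => ?_
    have hx := interior_subset hx
    have hx0 : 0 < x := hR.trans hx
    rw [(hda x hx).deriv]
    have h1 := mul_nonneg (h x hx) (pow_nonneg hx0.le (K - 1))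
    rcases K with _ | K
    · have := h x hx
      simp only [Nat.cast_zero, zero_mul, zero_add] at this
      simpa using (mul_nonneg_iff_of_pos_left hx0).1 this
    · rw [Nat.add_sub_cancel] at h1 ⊢
      rw [pow_succ]; nlinarith
  have hc : 0 < p (R + 1) * (R + 1) ^ K :=
    mul_pos (hpos _ (by simp)) (pow_pos (by linarith) K)
  have hInt' := hInt.mono_set (Set.Ioi_subset_Ioi (show R ≤ R + 1 by linarith))
  have hconst : IntegrableOn (fun _ : ℝ => p (R + 1) * (R + 1) ^ K) (Set.Ioi (R + 1)) := by
    refine Integrable.mono' hInt' aestronglyMeasurable_const ?_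
    filter_upwards [ae_restrict_mem measurableSet_Ioi] with x hx
    rw [Real.norm_of_nonneg hc.le]
    have hx : R + 1 < x := hx
    exact hmono (show R < R + 1 by linarith) (show R < x by linarith) hx.le
  rw [integrableOn_const_iff enorm_ne_top] at hconst
  rcases hconst with h | h
  · exact hc.ne' (enorm_eq_zero.1 h)
  · simp at h

section Infinity

variable {n : ℕ} {a : ℕ → ℝ[X]} {I : Set ℝ} {p : ℝ → ℝ}

lemma IsAdmissibleWeight.exists_Ioi (hp : IsAdmissibleWeight I p) {R₀ : ℝ}
    (hI : Set.Ioi R₀ ⊆ I) : ∃ R, 0 < R ∧ Set.Ioi R ⊆ I ∧ ContDiffOn ℝ ∞ p (Set.Ioi R) ∧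
      ∀ x ∈ Set.Ioi R, 0 < p x := by
  obtain ⟨S, hS, hsm, hpos⟩ := hp.piecewise_smooth_pos
  obtain ⟨B, hB⟩ := hS.bddAbove
  have hsub : Set.Ioi (max (max R₀ B) 1) ⊆ I \ S := fun x hx => by
    have hx : max (max R₀ B) 1 < x := hx
    simp only [max_lt_iff] at hx
    exact ⟨hI hx.1.1, fun h => absurd (hB h) (not_le.2 hx.1.2)⟩
  exact ⟨max (max R₀ B) 1, by simp, hsub.trans Set.sdiff_subset, hsm.mono hsub,
    fun x hx => hpos x (hsub hx)⟩

lemma not_eventually_weight_growth (hp : IsAdmissibleWeight I p) (h0 : a 0 = 0) (hn : a n ≠ 0)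
    (hsa : IsSelfAdjointFor n a I p) {R₀ : ℝ} (hI : Set.Ioi R₀ ⊆ I) (K : ℕ) :
    ¬ ∀ᶠ x in atTop, 0 ≤ K + x * ((weightNum n a).eval x / (a n).eval x) := by
  intro hK
  obtain ⟨R, hR, hRI, hsm, hpos⟩ := hp.exists_Ioi hI
  have hne : ∀ᶠ x in atTop, (a n).eval x ≠ 0 := by
    filter_upwards [Tendsto.eventually_ne (hasLevel_atTop (a n)) (leadingCoeff_ne_zero.2 hn)]
      with x hx h
    simp [h] at hx
  obtain ⟨R₁, hR₁⟩ := eventually_atTop.1 (hK.and hne)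
  have hsub : Set.Ioi (max R R₁) ⊆ Set.Ioi R := Set.Ioi_subset_Ioi (le_max_left _ _)
  refine not_integrableOn_mul_pow_of_deriv_nonneg (p := p) (lt_max_of_lt_left hR)
    ((hsm.mono hsub).differentiableOn (by simp)) (fun x hx => hpos x (hsub hx)) K
    (fun x hx => ?_) ?_
  · have hx' : max R R₁ < x := hx
    obtain ⟨h1, h2⟩ := hR₁ x ((le_max_right R R₁).trans hx'.le)
    have h3 := weight_ode h0 hn hsa isOpen_Ioi hRI hsm hpos (hsub hx)
    have hd : deriv p x = (weightNum n a).eval x / (a n).eval x * p x := by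
      field_simp; linarith
    have := mul_nonneg h1 (hpos x (hsub hx)).le
    rw [hd]; linarith
  · have := (hp.integrable (X ^ K)).mono_set (hsub.trans hRI)
    simpa using this

/-- At an infinite end of `I`: the degrees of `p' / p = N / a n`, and the bound on the degree of
the leading coefficient. -/
lemma infinite_end (hL : IsPolyDiffOpOfOrder n a) (hp : IsAdmissibleWeight I p) (h0 : a 0 = 0)
    (hsa : IsSelfAdjointFor n a I p) {R₀ : ℝ} (hI : Set.Ioi R₀ ⊆ I) :
    2 * (a n).natDegree ≤ n ∧ ((a n).natDegree = 0 ∨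
      (weightNum n a).natDegree = (a n).natDegree ∧
        (weightNum n a).leadingCoeff / (a n).leadingCoeff < 0) := by
  have hn := hL.leading_ne_zero
  set N := weightNum n a with hNdef
  have hlc := leadingCoeff_ne_zero.2 hn
  have hdeg : N ≠ 0 ∧ (a n).natDegree ≤ N.natDegree := by
    by_contra hcon
    -- If `deg N < deg a_n`, then `x p'/p` has a finite limit, and some `K` exceeding its negative
    -- makes `p x^K` eventually nondecreasing.
    have hlev : ∃ c, HasLevel atTop id ((a n).natDegree - 1) N c := by
      by_cases hN : N = 0
      · exact ⟨0, by simp [HasLevel, hN]⟩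
      · push Not at hcon
        exact (hasLevel_atTop N).mono tendsto_id (by have := hcon hN; omega)
    obtain ⟨c, hc⟩ := hlev
    have h1 := Tendsto.div hc (hasLevel_atTop (a n)) hlc
    obtain ⟨K, hK⟩ := exists_nat_gt (-(c / (a n).leadingCoeff))
    refine not_eventually_weight_growth hp h0 hn hsa hI K ?_
    filter_upwards [h1.eventually_const_lt (show -(K : ℝ) < _ by linarith),
      eventually_gt_atTop 0] with x hx hx0
    rw [Pi.div_apply] at hx
    have : N.eval x * id x ^ (-(((a n).natDegree : ℤ) - 1)) /
        ((a n).eval x * id x ^ (-((a n).natDegree : ℤ))) = x * (N.eval x / (a n).eval x) := by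
      rw [neg_sub, sub_eq_add_neg, zpow_add₀ (by exact hx0.ne'), zpow_one, ← mul_assoc,
        mul_div_mul_right _ _ (zpow_ne_zero _ (by exact hx0.ne'))]
      simp; ring
    rw [this] at hx
    linarith
  obtain ⟨R, hR, hRI, hsm, hpos⟩ := hp.exists_Ioi hI
  have hbd : ∀ k ≤ n, ∃ c', HasLevel atTop id (1 * k) (a k) c' := fun k hk => by
    refine (hasLevel_atTop (a k)).mono tendsto_id ?_
    rcases Nat.eq_zero_or_pos k with rfl | hk0
    · simp [h0]
    · have := hL.natDegree_le k (Finset.mem_Icc.2 ⟨hk0, hk⟩)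
      omega
  have hN : HasLevel atTop id ((a n).natDegree + ((N.natDegree : ℤ) - (a n).natDegree)) N
      N.leadingCoeff := by
    convert hasLevel_atTop N using 1; ring
  have hlcN := leadingCoeff_ne_zero.2 hdeg.1
  have key := place_bound isPlace_atTop (κ := (N.natDegree : ℤ) - (a n).natDegree) (β := 1)
    (by omega) (by omega) h0 hsa isOpen_Ioi hRI hsm hpos (Ioi_mem_atTop R) hbd hlc
    hlcN (hasLevel_atTop (a n)) hN
  -- The bound now reads `2 deg a_n ≤ n (1 - κ)`. For `κ = 0` the limit of `p'/p` must be negative,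
  -- else `p` itself would be eventually nondecreasing; for `κ ≥ 1` the degree is zero.
  obtain ⟨κ, hκ⟩ : ∃ κ : ℕ, N.natDegree = (a n).natDegree + κ := ⟨_, (Nat.add_sub_of_le hdeg.2).symm⟩
  have hκ' : (N.natDegree : ℤ) - (a n).natDegree = κ := by omega
  rw [hκ'] at key
  rcases Nat.eq_zero_or_pos κ with rfl | hκ0
  · refine ⟨by simp at key; omega, Or.inr ⟨by omega, ?_⟩⟩
    by_contra! hge
    have hpos' := lt_of_le_of_ne hge (div_ne_zero hlcN hlc).symm
    have h1 := Tendsto.div (hasLevel_atTop N) (hasLevel_atTop (a n)) hlc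
    refine not_eventually_weight_growth hp h0 hn hsa hI 0 ?_
    filter_upwards [h1.eventually_const_lt hpos', eventually_gt_atTop 0] with x hx hx0
    rw [Pi.div_apply, hκ, add_zero, mul_div_mul_right _ _ (zpow_ne_zero _ (by exact hx0.ne'))] at hx
    have := mul_pos hx0 hx
    simp only [Nat.cast_zero, zero_add]
    exact this.le
  · have h1 : (n : ℤ) * 1 ≤ n * κ := mul_le_mul_of_nonneg_left (by omega) (by omega)
    constructor
    · nlinarith
    · left; nlinarith

end Infinity

/-! ### Watson's lemma. -/

lemma integrableOn_rpow_mul_exp_neg_mul {σ t : ℝ} (hσ : -1 < σ) (ht : 0 < t) :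
    IntegrableOn (fun x => x ^ σ * Real.exp (-t * x)) (Set.Ioi 0) := by
  simpa using integrableOn_rpow_mul_exp_neg_mul_rpow (p := 1) hσ one_pos ht

lemma rpow_mul_integral_rpow_mul_exp {σ t : ℝ} (hσ : -1 < σ) (ht : 0 < t) :
    t ^ (σ + 1) * ∫ x in Set.Ioi 0, x ^ σ * Real.exp (-t * x) = Real.Gamma (σ + 1) := by
  have h := Real.integral_rpow_mul_exp_neg_mul_Ioi (a := σ + 1) (r := t) (by linarith) ht
  simp only [add_sub_cancel_right, ← neg_mul] at h
  rw [h, ← mul_assoc, ← Real.mul_rpow ht.le (by positivity), mul_one_div_cancel ht.ne',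
    Real.one_rpow, one_mul]

/-- Below a small `δ` the integrand is at most `η x^σ e^{-tx}`, whose scaled integral is `η Γ(σ + 1)
= ε/2`; beyond `δ` the factor `e^{-(t-1)δ}` beats every power of `t`. -/
lemma tendsto_laplace_zero {σ : ℝ} (hσ : -1 < σ) {v : ℝ → ℝ}
    (hv : IntegrableOn (fun x => v x * Real.exp (-x)) (Set.Ioi 0))
    (hv0 : Tendsto (fun x => v x * x ^ (-σ)) (𝓝[>] 0) (𝓝 0)) :
    Tendsto (fun t => t ^ (σ + 1) * ∫ x in Set.Ioi 0, v x * Real.exp (-t * x)) atTop (𝓝 0) := by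
  have hG : 0 < Real.Gamma (σ + 1) := Real.Gamma_pos_of_pos (by linarith)
  rw [Metric.tendsto_nhds]
  intro ε hε
  set η := ε / (2 * Real.Gamma (σ + 1)) with hη
  have hη0 : 0 < η := by positivity
  obtain ⟨δ, hδ, hδv⟩ : ∃ δ > 0, ∀ x, 0 < x → x < δ → |v x| ≤ η * x ^ σ := by
    have h1 := (Metric.tendsto_nhds.1 hv0) η hη0
    obtain ⟨δ, hδ, hsub⟩ := mem_nhdsGT_iff_exists_Ioo_subset.1 h1
    refine ⟨δ, hδ, fun x hx hxδ => ?_⟩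
    have h2 : dist (v x * x ^ (-σ)) 0 < η := hsub ⟨hx, hxδ⟩
    rw [Real.dist_eq, sub_zero, abs_mul, abs_of_pos (Real.rpow_pos_of_pos hx _),
      Real.rpow_neg hx.le, ← div_eq_mul_inv, div_lt_iff₀ (Real.rpow_pos_of_pos hx _)] at h2
    exact h2.le
  set K := ∫ x in Set.Ioi 0, |v x * Real.exp (-x)| with hK
  have htail : Tendsto (fun t : ℝ => t ^ (σ + 1) * (Real.exp (-(t - 1) * δ) * K)) atTop (𝓝 0) := by
    have h := ((tendsto_rpow_mul_exp_neg_mul_atTop_nhds_zero (σ + 1) δ hδ).mul_const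
      (Real.exp δ * K))
    rw [zero_mul] at h
    refine h.congr fun t => ?_
    have : Real.exp (-(t - 1) * δ) = Real.exp (-δ * t) * Real.exp δ := by
      rw [← Real.exp_add]; congr 1; ring
    rw [this]; ring
  filter_upwards [eventually_gt_atTop 1, htail.eventually_lt_const (half_pos hε)] with t ht ht2
  have ht0 : 0 < t := by linarith
  have htp := Real.rpow_pos_of_pos ht0 (σ + 1)
  rw [dist_zero_right, norm_mul, Real.norm_of_nonneg htp.le]
  have hi1 := (integrableOn_rpow_mul_exp_neg_mul hσ ht0).const_mul η
  have hi2 := hv.abs.const_mul (Real.exp (-(t - 1) * δ))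
  have hb : ‖∫ x in Set.Ioi 0, v x * Real.exp (-t * x)‖ ≤
      η * (∫ x in Set.Ioi 0, x ^ σ * Real.exp (-t * x)) + Real.exp (-(t - 1) * δ) * K := by
    rw [hK, ← integral_const_mul, ← integral_const_mul, ← integral_add hi1 hi2]
    refine norm_integral_le_of_norm_le (hi1.add hi2) ?_
    filter_upwards [ae_restrict_mem measurableSet_Ioi] with x hx
    have hx : 0 < x := hx
    have n1 : 0 ≤ η * (x ^ σ * Real.exp (-t * x)) := by positivity
    have n2 : 0 ≤ Real.exp (-(t - 1) * δ) * |v x * Real.exp (-x)| := by positivity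
    rw [norm_mul, Real.norm_of_nonneg (Real.exp_pos _).le, Real.norm_eq_abs]
    rcases lt_or_ge x δ with hxδ | hxδ
    · have := mul_le_mul_of_nonneg_right (hδv x hx hxδ) (Real.exp_pos (-t * x)).le
      linarith
    · have h1 : Real.exp (-t * x) ≤ Real.exp (-(t - 1) * δ) * Real.exp (-x) := by
        rw [← Real.exp_add]
        refine Real.exp_le_exp.2 ?_
        nlinarith
      have h2 := mul_le_mul_of_nonneg_left h1 (abs_nonneg (v x))
      rw [abs_mul, abs_of_pos (Real.exp_pos (-x))] at n2 ⊢
      linarith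
  have := mul_le_mul_of_nonneg_left hb htp.le
  have hexact := rpow_mul_integral_rpow_mul_exp hσ ht0
  have hηG : η * Real.Gamma (σ + 1) = ε / 2 := by rw [hη]; field_simp
  have e1 : t ^ (σ + 1) * (η * (∫ x in Set.Ioi 0, x ^ σ * Real.exp (-t * x)) +
      Real.exp (-(t - 1) * δ) * K) = η * Real.Gamma (σ + 1) +
        t ^ (σ + 1) * (Real.exp (-(t - 1) * δ) * K) := by
    rw [← hexact]; ring
  rw [e1, hηG] at this
  linarith

/-- Watson's lemma, leading term. -/
lemma tendsto_laplace {σ c : ℝ} (hσ : -1 < σ) {w : ℝ → ℝ} (hw : IntegrableOn w (Set.Ioi 0))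
    (hw0 : Tendsto (fun x => w x * x ^ (-σ)) (𝓝[>] 0) (𝓝 c)) :
    Tendsto (fun t => t ^ (σ + 1) * ∫ x in Set.Ioi 0, w x * Real.exp (-t * x)) atTop
      (𝓝 (c * Real.Gamma (σ + 1))) := by
  have hexp : ∀ t : ℝ, 0 < t → IntegrableOn (fun x => w x * Real.exp (-t * x)) (Set.Ioi 0) := by
    intro t ht
    refine Integrable.mono hw (hw.aestronglyMeasurable.mul (by fun_prop)) ?_
    filter_upwards [ae_restrict_mem measurableSet_Ioi] with x hx
    have hx : 0 < x := hx
    rw [norm_mul, Real.norm_of_nonneg (Real.exp_pos _).le]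
    exact mul_le_of_le_one_right (norm_nonneg _) (Real.exp_le_one_iff.2 (by nlinarith))
  have hv : IntegrableOn (fun x => (w x - c * x ^ σ) * Real.exp (-x)) (Set.Ioi 0) := by
    have h := (hexp 1 one_pos).sub
      ((integrableOn_rpow_mul_exp_neg_mul hσ one_pos).const_mul c)
    refine h.congr (Eventually.of_forall fun x => ?_)
    simp only [Pi.sub_apply, neg_mul, one_mul]; ring
  have hv0 : Tendsto (fun x => (w x - c * x ^ σ) * x ^ (-σ)) (𝓝[>] 0) (𝓝 0) := by
    have h := hw0.sub_const c
    rw [sub_self] at h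
    refine h.congr' ?_
    filter_upwards [self_mem_nhdsWithin] with x hx
    have hx : (0 : ℝ) < x := hx
    have : x ^ σ * x ^ (-σ) = 1 := by rw [← Real.rpow_add hx]; simp
    linear_combination c * this
  have h := (tendsto_laplace_zero hσ hv hv0).add_const (c * Real.Gamma (σ + 1))
  rw [zero_add] at h
  refine h.congr' ?_
  filter_upwards [eventually_gt_atTop 0] with t ht
  have e1 : ∫ x in Set.Ioi 0, (w x - c * x ^ σ) * Real.exp (-t * x) =
      (∫ x in Set.Ioi 0, w x * Real.exp (-t * x)) -
        c * ∫ x in Set.Ioi 0, x ^ σ * Real.exp (-t * x) := by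
    rw [← integral_const_mul, ← integral_sub (hexp t ht)
      ((integrableOn_rpow_mul_exp_neg_mul hσ ht).const_mul c)]
    exact integral_congr_ae (Eventually.of_forall fun x => by ring)
  rw [e1, ← rpow_mul_integral_rpow_mul_exp hσ ht]
  ring

/-! ### The weight at a regular singular endpoint. -/

/-- A positive solution of `A p' = N p` near a regular singular point is asymptotic to a power. -/
lemma exists_tendsto_mul_rpow {p : ℝ → ℝ} {δ : ℝ} (hδ : 0 < δ)
    (hd : DifferentiableOn ℝ p (Set.Ioo 0 δ)) (hpos : ∀ x ∈ Set.Ioo 0 δ, 0 < p x) {A N : ℝ[X]}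
    (hode : ∀ x ∈ Set.Ioo 0 δ, A.eval x * deriv p x = N.eval x * p x) {m : ℕ} (hA : X ^ m ∣ A)
    (hAm : A.coeff m ≠ 0) (hN : X ^ m ∣ X * N) :
    ∃ c > 0, Tendsto (fun x => p x * x ^ (-((X * N).coeff m / A.coeff m))) (𝓝[>] 0) (𝓝 c) := by
  set s := (X * N).coeff m / A.coeff m with hs
  obtain ⟨A₁, hA₁⟩ := hA
  obtain ⟨B, hB⟩ := hN
  have cA : A.coeff m = A₁.eval 0 := by
    rw [hA₁, ← coeff_zero_eq_eval_zero]; simpa using coeff_X_pow_mul A₁ m 0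
  have cB : (X * N).coeff m = B.eval 0 := by
    rw [hB, ← coeff_zero_eq_eval_zero]; simpa using coeff_X_pow_mul B m 0
  rw [cA] at hAm
  -- With `A = x^m A₁` and `x N = x^m B`, the exponent `s = B(0)/A₁(0)` removes the pole: `log p - s
  -- log x` has the bounded derivative `G / A₁`. It is therefore Lipschitz and extends continuously
  -- to `0`.
  obtain ⟨G, hG⟩ : X ∣ B - C s * A₁ := by
    rw [X_dvd_iff, coeff_zero_eq_eval_zero, eval_sub, eval_mul, eval_C, hs, cA, cB]
    field_simp
    ring
  have hcont : ContinuousAt (fun x => G.eval x / A₁.eval x) 0 :=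
    G.continuous.continuousAt.div A₁.continuous.continuousAt hAm
  obtain ⟨K, hK⟩ : ∃ K : NNReal, ∀ᶠ x in 𝓝 (0 : ℝ), ‖G.eval x / A₁.eval x‖₊ ≤ K := by
    refine ⟨‖G.eval 0 / A₁.eval 0‖₊ + 1, ?_⟩
    filter_upwards [hcont.nnnorm.eventually_lt_const (lt_add_one _)] with x hx using hx.le
  have hne : ∀ᶠ x in 𝓝 (0 : ℝ), A₁.eval x ≠ 0 :=
    A₁.continuous.continuousAt.eventually_ne hAm
  have hev : ∀ᶠ x in 𝓝[>] (0 : ℝ), x ∈ Set.Ioo 0 δ ∧ ‖G.eval x / A₁.eval x‖₊ ≤ K ∧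
      A₁.eval x ≠ 0 := by
    filter_upwards [Ioo_mem_nhdsGT hδ, nhdsWithin_le_nhds hK, nhdsWithin_le_nhds hne] with x h1 h2 h3
    exact ⟨h1, h2, h3⟩
  obtain ⟨δ', hδ', hsub⟩ := mem_nhdsGT_iff_exists_Ioo_subset.1 hev
  have hF : ∀ x ∈ Set.Ioo 0 δ', HasDerivAt (fun x => Real.log (p x) - s * Real.log x)
      (G.eval x / A₁.eval x) x := by
    intro x hx
    obtain ⟨h1, -, h3⟩ := hsub hx
    have hx0 : x ≠ 0 := hx.1.ne'
    have hpx := (hpos x h1).ne'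
    have hp' := ((hd.differentiableAt (isOpen_Ioo.mem_nhds h1)).hasDerivAt).log hpx
    refine (hp'.sub ((Real.hasDerivAt_log hx0).const_mul s)).congr_deriv ?_
    have e1 := hode x h1
    have e2 := congrArg (eval x) hB
    have e3 := congrArg (eval x) hG
    simp only [hA₁, eval_mul, eval_pow, eval_X, eval_sub, eval_C] at e1 e2 e3
    have hxm : x ^ m ≠ 0 := pow_ne_zero _ hx0
    have e4 : x * A₁.eval x * deriv p x = B.eval x * p x := by
      refine mul_left_cancel₀ hxm ?_
      linear_combination x * e1 + p x * e2
    field_simp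
    linear_combination e4 + p x * e3
  have hLip : LipschitzOnWith K (fun x => Real.log (p x) - s * Real.log x) (Set.Ioo 0 δ') :=
    (convex_Ioo 0 δ').lipschitzOnWith_of_nnnorm_hasDerivWithin_le
      (fun x hx => (hF x hx).hasDerivWithinAt) fun x hx => (hsub hx).2.1
  obtain ⟨g, hg, hgeq⟩ := hLip.extend_real
  refine ⟨Real.exp (g 0), Real.exp_pos _, ?_⟩
  have hlim : Tendsto (fun x => Real.exp (g x)) (𝓝[>] 0) (𝓝 (Real.exp (g 0))) :=
    (Real.continuous_exp.comp hg.continuous).continuousAt.tendsto.mono_left nhdsWithin_le_nhds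
  refine hlim.congr' ?_
  filter_upwards [Ioo_mem_nhdsGT hδ'] with x hx
  rw [← hgeq hx, Real.exp_sub, Real.exp_log (hpos x (hsub hx).1), Real.rpow_neg hx.1.le,
    Real.rpow_def_of_pos hx.1, mul_comm s, div_eq_mul_inv]

lemma neg_one_lt_of_integrableOn {p : ℝ → ℝ} {δ s c : ℝ} (hδ : 0 < δ) (hc : 0 < c)
    (hInt : IntegrableOn p (Set.Ioo 0 δ))
    (hp : Tendsto (fun x => p x * x ^ (-s)) (𝓝[>] 0) (𝓝 c)) : -1 < s := by
  have h1 := hp.eventually_const_lt (half_lt_self hc)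
  obtain ⟨δ', hδ', hsub⟩ := mem_nhdsGT_iff_exists_Ioo_subset.1 (h1.and (Ioo_mem_nhdsGT hδ))
  refine (intervalIntegral.integrableOn_Ioo_rpow_iff hδ').1 ?_
  have h2 : IntegrableOn p (Set.Ioo 0 δ') := hInt.mono_set fun x hx => (hsub hx).2
  refine Integrable.mono' (h2.const_mul (2 / c))
    ((continuousOn_id.rpow_const fun x hx => Or.inl hx.1.ne').aestronglyMeasurable
      measurableSet_Ioo) ?_
  filter_upwards [ae_restrict_mem measurableSet_Ioo] with x hx
  have hxs := Real.rpow_pos_of_pos hx.1 s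
  have h3 : c / 2 < p x * x ^ (-s) := (hsub hx).1
  rw [Real.rpow_neg hx.1.le, ← div_eq_mul_inv, lt_div_iff₀ hxs] at h3
  rw [Real.norm_of_nonneg hxs.le]
  have := mul_le_mul_of_nonneg_left h3.le (show 0 ≤ 2 / c by positivity)
  calc x ^ s = 2 / c * (c / 2 * x ^ s) := by field_simp
    _ ≤ _ := this

/-! ### Self-adjointness tested on exponentials. -/

/-- A smooth function of temperate growth equal to `exp (-t x)` for `x ≥ 0`. -/
noncomputable def expCutoff (t x : ℝ) : ℝ := Real.smoothTransition (x + 1) * Real.exp (-t * x)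

lemma expCutoff_of_nonneg {t x : ℝ} (hx : 0 ≤ x) : expCutoff t x = Real.exp (-t * x) := by
  rw [expCutoff, Real.smoothTransition.one_of_one_le (by linarith), one_mul]

lemma iteratedDeriv_expCutoff {t x : ℝ} (hx : 0 < x) (k : ℕ) :
    iteratedDeriv k (expCutoff t) x = (-t) ^ k * Real.exp (-t * x) := by
  have h : expCutoff t =ᶠ[𝓝 x] fun x => Real.exp (-t * x) := by
    filter_upwards [Ioi_mem_nhds hx] with z hz using expCutoff_of_nonneg (le_of_lt hz)
  rw [h.iteratedDeriv_eq, iteratedDeriv_exp_const_mul]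

lemma contDiff_expCutoff (t : ℝ) : ContDiff ℝ ∞ (expCutoff t) := by
  refine ContDiff.mul (Real.smoothTransition.contDiff.comp (contDiff_id.add contDiff_const)) ?_
  fun_prop

lemma hasTemperateGrowth_expCutoff {t : ℝ} (ht : 0 ≤ t) :
    Function.HasTemperateGrowth (expCutoff t) := by
  refine ⟨contDiff_expCutoff t, fun k => ⟨0, ?_⟩⟩
  have hcont : Continuous (iteratedDeriv k (expCutoff t)) :=
    (contDiffOn_univ.1 (contDiffOn_iteratedDeriv isOpen_univ
      (contDiff_expCutoff t).contDiffOn k)).continuous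
  obtain ⟨K, hK⟩ := (isCompact_Icc (a := (-1 : ℝ)) (b := 0)).exists_bound_of_continuousOn
    hcont.continuousOn
  refine ⟨max K (t ^ k), fun x => ?_⟩
  rw [norm_iteratedFDeriv_eq_norm_iteratedDeriv, pow_zero, mul_one]
  rcases lt_or_ge 0 x with hx | hx
  · rw [iteratedDeriv_expCutoff hx, norm_mul, norm_pow, norm_neg, Real.norm_of_nonneg ht,
      Real.norm_of_nonneg (Real.exp_pos _).le]
    exact le_max_of_le_right (mul_le_of_le_one_right (by positivity)
      (Real.exp_le_one_iff.2 (by nlinarith)))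
  rcases le_or_gt (-1) x with hx' | hx'
  · exact le_max_of_le_left (hK x ⟨hx', hx⟩)
  · have h : expCutoff t =ᶠ[𝓝 x] fun _ => 0 := by
      filter_upwards [Iio_mem_nhds hx'] with z hz
      have hz : z < -1 := hz
      rw [expCutoff, Real.smoothTransition.zero_of_nonpos (by linarith), zero_mul]
    have h0 : iteratedDeriv k (expCutoff t) x = 0 := by
      rw [h.iteratedDeriv_eq]; simp
    rw [h0, norm_zero]
    exact le_max_of_le_right (by positivity)

section Laplace

variable {n : ℕ} {a : ℕ → ℝ[X]} {I : Set ℝ} {p : ℝ → ℝ}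

lemma setIntegral_eq_integral_Ioi_indicator (hIm : MeasurableSet I) (hI0 : I ⊆ Set.Ici 0)
    (w : ℝ → ℝ) : ∫ x in I, w x = ∫ x in Set.Ioi 0, I.indicator w x := by
  rw [← integral_Ici_eq_integral_Ioi, setIntegral_indicator hIm, Set.inter_eq_right.2 hI0]

lemma integrableOn_mul_exp (hp : IsAdmissibleWeight I p) (hIm : MeasurableSet I)
    (hI0 : I ⊆ Set.Ici 0) {t : ℝ} (ht : 0 ≤ t) (f : ℝ[X]) :
    IntegrableOn (fun x => p x * f.eval x * Real.exp (-t * x)) I := by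
  refine Integrable.mono (hp.integrable f)
    ((hp.integrable f).aestronglyMeasurable.mul (by fun_prop)) ?_
  filter_upwards [ae_restrict_mem hIm] with x hx
  have hx : 0 ≤ x := hI0 hx
  rw [norm_mul, Real.norm_of_nonneg (Real.exp_pos _).le]
  exact mul_le_of_le_one_right (norm_nonneg _) (Real.exp_le_one_iff.2 (by nlinarith))

lemma tendsto_weighted_laplace (hp : IsAdmissibleWeight I p) (hIm : MeasurableSet I)
    (hI0 : I ⊆ Set.Ici 0) {δ : ℝ} (hδ : 0 < δ) (hδI : Set.Ioo 0 δ ⊆ I) {s c : ℝ} (hs : -1 < s)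
    (hlim : Tendsto (fun x => p x * x ^ (-s)) (𝓝[>] 0) (𝓝 c)) {f : ℝ[X]} {e : ℕ}
    (hf : X ^ e ∣ f) :
    Tendsto (fun t => t ^ (s + 1 + e) * ∫ x in I, p x * f.eval x * Real.exp (-t * x)) atTop
      (𝓝 (c * f.coeff e * Real.Gamma (s + 1 + e))) := by
  have hw : IntegrableOn (I.indicator fun x => p x * f.eval x) (Set.Ioi 0) :=
    ((integrable_indicator_iff hIm).2 (hp.integrable f)).integrableOn
  have hw0 : Tendsto (fun x => (I.indicator fun x => p x * f.eval x) x * x ^ (-(s + e))) (𝓝[>] 0)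
      (𝓝 (c * f.coeff e)) := by
    refine (hlim.mul (hasLevel_zero hf)).congr' ?_
    filter_upwards [Ioo_mem_nhdsGT hδ] with x hx
    rw [Set.indicator_of_mem (hδI hx), neg_add, Real.rpow_add hx.1, Real.rpow_neg hx.1.le (e : ℝ),
      Real.rpow_natCast, neg_neg, zpow_natCast, inv_pow]
    ring
  have h := tendsto_laplace (σ := s + e) (by have := Nat.cast_nonneg (α := ℝ) e; linarith) hw hw0
  have e1 : s + e + 1 = s + 1 + e := by ring
  rw [e1] at h
  refine h.congr fun t => ?_
  rw [setIntegral_eq_integral_Ioi_indicator hIm hI0]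
  congr 1
  refine integral_congr_ae (Eventually.of_forall fun x => ?_)
  by_cases hx : x ∈ I <;> simp [hx]

lemma laplace_identity (hp : IsAdmissibleWeight I p) (h0 : a 0 = 0)
    (hsa : IsSelfAdjointFor n a I p) (hIm : MeasurableSet I)
    (hI0 : I ⊆ Set.Ici 0) {t : ℝ} (ht : 0 ≤ t) (u : ℝ[X]) :
    ∑ k ∈ Finset.range (n + 1), (-t) ^ k *
        ∫ x in I, p x * (a k * u).eval x * Real.exp (-t * x) =
      ∫ x in I, p x * (∑ k ∈ Finset.range (n + 1), a k * derivative^[k] u).eval x *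
        Real.exp (-t * x) := by
  have h := hsa _ _ (hasTemperateGrowth_expCutoff ht) (hasTemperateGrowth_polynomial u)
  have hae : ∀ᵐ x ∂(volume.restrict I), 0 < x := by
    have h1 : ∀ᵐ x : ℝ ∂volume, x ≠ 0 := by simp [ae_iff]
    filter_upwards [ae_restrict_mem hIm, ae_restrict_of_ae h1] with x hx hx0
    exact lt_of_le_of_ne (hI0 hx) hx0.symm
  have e1 : weightedInner I p (polyDiffOp n a (expCutoff t)) (fun x => u.eval x) =
      ∑ k ∈ Finset.range (n + 1), (-t) ^ k *
        ∫ x in I, p x * (a k * u).eval x * Real.exp (-t * x) := by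
    simp_rw [← integral_const_mul]
    rw [← integral_finsetSum _ fun k _ =>
      (integrableOn_mul_exp hp hIm hI0 ht (a k * u)).const_mul _]
    refine integral_congr_ae ?_
    filter_upwards [hae] with x hx
    rw [polyDiffOp_eq_sum_range h0, Finset.mul_sum, Finset.sum_mul]
    refine Finset.sum_congr rfl fun k _ => ?_
    rw [iteratedDeriv_expCutoff hx, eval_mul]; ring
  rw [← e1, h]
  refine integral_congr_ae ?_
  filter_upwards [hae] with x hx
  rw [polyDiffOp_polynomial h0, expCutoff_of_nonneg hx.le]
  ring

/-- In `⟨L e^{-tx}, x^j⟩ = ⟨e^{-tx}, L x^j⟩` the terms with `k ≥ d` on the left have size at most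
`t^(d-j-s-1)`, those with `k < d` are smaller, and the right side is `O(t^(-s-1))`, also smaller as
`j < d`. So the leading coefficients, given by Watson's lemma, sum to zero. -/
lemma sum_coeff_mul_Gamma_eq_zero (hp : IsAdmissibleWeight I p) (h0 : a 0 = 0)
    (hsa : IsSelfAdjointFor n a I p) (hIm : MeasurableSet I)
    (hI0 : I ⊆ Set.Ici 0) {δ : ℝ} (hδ : 0 < δ) (hδI : Set.Ioo 0 δ ⊆ I) {s c : ℝ} (hs : -1 < s)
    (hc : 0 < c) (hlim : Tendsto (fun x => p x * x ^ (-s)) (𝓝[>] 0) (𝓝 c)) {d : ℕ} (hdn : d ≤ n)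
    (hd : ∀ k ≤ n, X ^ (k - d) ∣ a k) {j : ℕ} (hj : j < d) :
    ∑ i ∈ Finset.range (n - d + 1), (-1) ^ (i + d) * (a (i + d)).coeff i *
      Real.Gamma (s + 1 + j + i) = 0 := by
  set Lf : ℝ[X] := ∑ k ∈ Finset.range (n + 1), a k * derivative^[k] (X ^ j) with hLf
  have W := fun (f : ℝ[X]) (e : ℕ) (h : X ^ e ∣ f) =>
    tendsto_weighted_laplace hp hIm hI0 hδ hδI hs hlim h
  have hR : Tendsto (fun t : ℝ => t ^ (s + 1 + j - d) *
      ∫ x in I, p x * Lf.eval x * Real.exp (-t * x)) atTop (𝓝 0) := by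
    have h1 := W Lf 0 (by simp)
    have h2 : Tendsto (fun t : ℝ => t ^ (-((d : ℝ) - j))) atTop (𝓝 0) :=
      tendsto_rpow_neg_atTop (sub_pos.2 (by exact_mod_cast hj))
    have h3 := h2.mul h1
    rw [zero_mul] at h3
    refine h3.congr' ?_
    filter_upwards [eventually_gt_atTop 0] with t ht
    rw [← mul_assoc, ← Real.rpow_add ht]
    congr 2
    push_cast; ring
  have hT : ∀ k ∈ Finset.range (n + 1), Tendsto (fun t : ℝ => t ^ (s + 1 + j - d) * ((-t) ^ k *
      ∫ x in I, p x * (a k * X ^ j).eval x * Real.exp (-t * x))) atTop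
      (𝓝 (if d ≤ k then c * ((-1) ^ k * (a k).coeff (k - d) *
        Real.Gamma (s + 1 + j + (k - d : ℕ))) else 0)) := by
    intro k hk
    have hk : k ≤ n := by simpa [Nat.lt_succ_iff] using hk
    split_ifs with hdk
    · have h1 := (W (a k * X ^ j) (k - d + j) (by
        rw [pow_add]; exact mul_dvd_mul_right (hd k hk) _)).const_mul ((-1) ^ k)
      have e1 : (-1) ^ k * (c * (a k * X ^ j).coeff (k - d + j) *
          Real.Gamma (s + 1 + (k - d + j : ℕ))) = c * ((-1) ^ k * (a k).coeff (k - d) *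
            Real.Gamma (s + 1 + j + (k - d : ℕ))) := by
        rw [coeff_mul_X_pow]
        push_cast
        rw [show s + 1 + (((k - d : ℕ) : ℝ) + j) = s + 1 + j + (k - d : ℕ) by ring]
        ring
      rw [e1] at h1
      refine h1.congr' ?_
      filter_upwards [eventually_gt_atTop 0] with t ht
      have e2 : t ^ (s + 1 + (k - d + j : ℕ)) = t ^ (s + 1 + j - d) * t ^ k := by
        rw [← Real.rpow_natCast t k, ← Real.rpow_add ht]
        congr 1
        push_cast [hdk]; ring
      rw [e2, neg_pow t k]; ring
    · have h1 := W (a k * X ^ j) j (Dvd.intro_left _ rfl)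
      have h2 : Tendsto (fun t : ℝ => t ^ (-((d : ℝ) - k))) atTop (𝓝 0) :=
        tendsto_rpow_neg_atTop (sub_pos.2 (by exact_mod_cast not_le.1 hdk))
      have h3 := (h2.mul h1).const_mul ((-1) ^ k)
      rw [zero_mul, mul_zero] at h3
      refine h3.congr' ?_
      filter_upwards [eventually_gt_atTop 0] with t ht
      have e2 : t ^ (-((d : ℝ) - k)) * t ^ (s + 1 + j) = t ^ (s + 1 + j - d) * t ^ k := by
        rw [← Real.rpow_natCast t k, ← Real.rpow_add ht, ← Real.rpow_add ht]
        congr 1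
        ring
      rw [neg_pow t k]
      linear_combination (-1) ^ k * (∫ x in I, p x * (a k * X ^ j).eval x * Real.exp (-t * x)) * e2
  have hsum := tendsto_finsetSum _ hT
  have hsum0 : ∑ k ∈ Finset.range (n + 1), (if d ≤ k then c * ((-1) ^ k * (a k).coeff (k - d) *
        Real.Gamma (s + 1 + j + (k - d : ℕ))) else 0) = 0 := by
    refine tendsto_nhds_unique hsum (hR.congr' ?_)
    filter_upwards [eventually_ge_atTop 0] with t ht
    rw [← Finset.mul_sum, laplace_identity hp h0 hsa hIm hI0 ht]
  have hn1 : n + 1 = d + (n - d + 1) := by omega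
  rw [hn1, Finset.sum_range_add, Finset.sum_eq_zero, zero_add] at hsum0
  · refine (mul_eq_zero.1 ((?_ : c * _ = 0))).resolve_left hc.ne'
    rw [← hsum0, Finset.mul_sum]
    refine Finset.sum_congr rfl fun i _ => ?_
    rw [if_pos (by omega), Nat.add_sub_cancel_left, add_comm d i]
  · intro k hk
    rw [if_neg (by simpa using hk)]

end Laplace

/-! ### Vanishing sums of Gamma values. -/

lemma Gamma_add_natCast {z : ℝ} (hz : 0 < z) (i : ℕ) :
    Real.Gamma (z + i) = (ascPochhammer ℝ i).eval z * Real.Gamma z := by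
  induction i with
  | zero => simp
  | succ i ih =>
    rw [ascPochhammer_succ_eval, Nat.cast_succ, ← add_assoc, Real.Gamma_add_one (by positivity), ih]
    ring

lemma eq_zero_of_sum_ascPochhammer {c : ℕ → ℝ} {m : ℕ}
    (h : ∑ i ∈ Finset.range m, C (c i) * ascPochhammer ℝ i = 0) : ∀ i < m, c i = 0 := by
  induction m with
  | zero => simp
  | succ m ih =>
    have hm : c m = 0 := by
      have h1 := congrArg (fun f : ℝ[X] => f.coeff m) h
      simp only [Finset.sum_range_succ, coeff_add, finsetSum_coeff, coeff_C_mul, coeff_zero] at h1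
      have h2 : (ascPochhammer ℝ m).coeff m = 1 := by
        have := (monic_ascPochhammer ℝ m).coeff_natDegree
        rwa [ascPochhammer_natDegree] at this
      rw [Finset.sum_eq_zero, h2] at h1
      · simpa using h1
      · intro i hi
        rw [coeff_eq_zero_of_natDegree_lt, mul_zero]
        rw [ascPochhammer_natDegree]
        exact Finset.mem_range.1 hi
    rw [Finset.sum_range_succ, hm, C_0, zero_mul, add_zero] at h
    intro i hi
    rcases Nat.lt_succ_iff_lt_or_eq.1 hi with h' | rfl
    · exact ih h i h'
    · exact hm

/-- Dividing by `Γ(s + 1 + j)` turns the sums into values of `∑ c_i (z)_i`, with rising factorials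
`(z)_i`, at `d` distinct points. Its degree is at most `n - d`, so `d > n - d` would force all `c_i`
to vanish. -/
lemma two_mul_le_of_sum_Gamma {c : ℕ → ℝ} {n d : ℕ} (hdn : d ≤ n) {s : ℝ} (hs : -1 < s)
    (h : ∀ j < d, ∑ i ∈ Finset.range (n - d + 1), c i * Real.Gamma (s + 1 + j + i) = 0)
    (hc : ∃ i ≤ n - d, c i ≠ 0) : 2 * d ≤ n := by
  by_contra! hlt
  set g : ℝ[X] := ∑ i ∈ Finset.range (n - d + 1), C (c i) * ascPochhammer ℝ i with hg
  have hdeg : g.natDegree ≤ n - d := natDegree_sum_le_of_forall_le _ _ fun i hi =>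
    (natDegree_C_mul_le _ _).trans (by
      rw [ascPochhammer_natDegree]; simpa [Nat.lt_succ_iff] using hi)
  have hg0 : g = 0 := by
    refine eq_zero_of_natDegree_lt_card_of_eval_eq_zero g (ι := Fin d)
      (f := fun j => s + 1 + (j : ℕ)) (fun i j hij => ?_) (fun j => ?_) ?_
    · have : ((i : ℕ) : ℝ) = (j : ℕ) := by simpa using hij
      exact Fin.ext (by exact_mod_cast this)
    · have hz : 0 < s + 1 + ((j : ℕ) : ℝ) := by
        have := Nat.cast_nonneg (α := ℝ) (j : ℕ)
        linarith
      have h1 := h j j.2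
      simp_rw [Gamma_add_natCast hz, ← mul_assoc, ← Finset.sum_mul] at h1
      have h2 := (mul_eq_zero.1 h1).resolve_right (Real.Gamma_pos_of_pos hz).ne'
      rw [hg, eval_finsetSum]
      simpa using h2
    · rw [Fintype.card_fin]; omega
  obtain ⟨i, hi, hci⟩ := hc
  exact hci (eq_zero_of_sum_ascPochhammer hg0 i (by omega))

lemma rootMultiplicity_zero_eq {f : ℝ[X]} {k : ℕ} (h : ∀ i < k, f.coeff i = 0)
    (hk : f.coeff k ≠ 0) : f.rootMultiplicity 0 = k := by
  rw [rootMultiplicity_eq_natTrailingDegree']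
  refine le_antisymm (natTrailingDegree_le_of_ne_zero hk) (le_natTrailingDegree ?_ h)
  rintro rfl
  simp at hk

/-! ### Multiplicities at a left endpoint placed at zero. -/

section Endpoint

variable {n : ℕ} {a : ℕ → ℝ[X]} {I : Set ℝ} {p : ℝ → ℝ}

lemma IsAdmissibleWeight.exists_Ioo (hp : IsAdmissibleWeight I p) {δ₀ : ℝ} (hδ₀ : 0 < δ₀)
    (hI : Set.Ioo 0 δ₀ ⊆ I) : ∃ δ, 0 < δ ∧ Set.Ioo 0 δ ⊆ I ∧ ContDiffOn ℝ ∞ p (Set.Ioo 0 δ) ∧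
      ∀ x ∈ Set.Ioo 0 δ, 0 < p x := by
  obtain ⟨S, hS, hsm, hpos⟩ := hp.piecewise_smooth_pos
  have hev : ∀ᶠ x in 𝓝[>] (0 : ℝ), x ∈ I \ S := by
    have h1 : (S \ {0})ᶜ ∈ 𝓝 (0 : ℝ) :=
      (hS.subset Set.sdiff_subset).isClosed.isOpen_compl.mem_nhds (by simp)
    filter_upwards [Ioo_mem_nhdsGT hδ₀, nhdsWithin_le_nhds h1] with x hx hx'
    exact ⟨hI hx, fun h => hx' ⟨h, hx.1.ne'⟩⟩
  obtain ⟨δ, hδ, hsub⟩ := mem_nhdsGT_iff_exists_Ioo_subset.1 hev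
  exact ⟨δ, hδ, fun x hx => (hsub hx).1, hsm.mono hsub, fun x hx => hpos x (hsub hx)⟩

lemma weightNum_coeff (hn : n ≠ 0) (i : ℕ) :
    (a (n - 1)).coeff i = n / 2 * ((weightNum n a).coeff i + (a n).coeff (i + 1) * (i + 1)) := by
  have : (n : ℝ) ≠ 0 := by exact_mod_cast hn
  rw [weightNum, coeff_sub, coeff_C_mul, coeff_derivative]
  field_simp
  ring

/-- The case of an irregular singular point of the weight. -/
lemma irregular_endpoint (hn : 2 < n) (hL : IsPolyDiffOpOfOrder n a)
    (hp : IsAdmissibleWeight I p) (h0 : a 0 = 0) (hsa : IsSelfAdjointFor n a I p)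
    {δ₀ : ℝ} (hδ₀ : 0 < δ₀) (hI : Set.Ioo 0 δ₀ ⊆ I)
    (hirr : ¬ X ^ (a n).natTrailingDegree ∣ X * weightNum n a) :
    (a n).natTrailingDegree = n ∧ (a (n - 1)).rootMultiplicity 0 = n - 2 := by
  have hL0 := hL.leading_ne_zero
  obtain ⟨δ, hδ, hδI, hsm, hpos⟩ := hp.exists_Ioo hδ₀ hI
  set N := weightNum n a with hNdef
  set m := (a n).natTrailingDegree with hm
  have hN : N ≠ 0 := by
    intro h; simp [h] at hirr
  have hν : N.natTrailingDegree + 1 < m := by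
    by_contra! hle
    refine hirr ((pow_dvd_pow X hle).trans ?_)
    rw [pow_succ']
    exact mul_dvd_mul_left X (X_pow_natTrailingDegree_dvd N)
  have hbd : ∀ k ≤ n, ∃ c', HasLevel (𝓝[>] 0) (fun x => x⁻¹) (0 * k) (a k) c' := fun k _ =>
    ⟨_, by simpa using hasLevel_zero (f := a k) (m := 0) (by simp)⟩
  have key := place_bound isPlace_zero (κ := (m : ℤ) - N.natTrailingDegree) (β := 0)
    (e := -(m : ℤ)) (by omega) (by omega) h0 hsa isOpen_Ioo hδI hsm hpos (Ioo_mem_nhdsGT hδ) hbd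
    (trailingCoeff_nonzero_iff_nonzero.2 hL0) (trailingCoeff_nonzero_iff_nonzero.2 hN)
    (hasLevel_zero (X_pow_natTrailingDegree_dvd (a n)))
    (by
      convert hasLevel_zero (X_pow_natTrailingDegree_dvd N) using 1
      · ring
      · rfl)
  -- Irregularity means that `p'/p` has a pole of order `κ + 2 ≥ 2`. The bound becomes `n (κ + 2) ≤
  -- 2 m ≤ 2 n`, which forces `κ = 0` and `m = n`.
  obtain ⟨κ, hκ⟩ : ∃ κ, m = N.natTrailingDegree + (κ + 2) := ⟨m - N.natTrailingDegree - 2, by omega⟩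
  have hκ' : (m : ℤ) - N.natTrailingDegree = κ + 2 := by omega
  rw [hκ'] at key
  have hmn : m ≤ n := (natTrailingDegree_le_natDegree _).trans
    (hL.natDegree_le n (Finset.mem_Icc.2 ⟨by omega, le_rfl⟩))
  have hmn' : (m : ℤ) ≤ n := by exact_mod_cast hmn
  have hκ0 : κ = 0 := by
    by_contra hne
    have h1 : (n : ℤ) * 1 ≤ n * κ := mul_le_mul_of_nonneg_left (by omega) (by omega)
    nlinarith
  subst hκ0
  have hm_eq : m = n := by
    push_cast at key
    omega
  refine ⟨hm_eq, ?_⟩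
  have hNt : N.natTrailingDegree = n - 2 := by omega
  have hacoeff : ∀ i < n, (a n).coeff i = 0 := fun i hi =>
    coeff_eq_zero_of_lt_natTrailingDegree (by omega)
  refine rootMultiplicity_zero_eq (fun i hi => ?_) ?_
  · rw [weightNum_coeff (by omega), hacoeff (i + 1) (by omega), ← hNdef,
      coeff_eq_zero_of_lt_natTrailingDegree (by omega)]
    simp
  · rw [weightNum_coeff (by omega), hacoeff (n - 2 + 1) (by omega), ← hNdef, ← hNt, zero_mul,
      add_zero]
    have : (n : ℝ) ≠ 0 := by exact_mod_cast (by omega : n ≠ 0)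
    exact mul_ne_zero (by positivity) (trailingCoeff_nonzero_iff_nonzero.2 hN)

/-- The case of a regular singular point of the weight. -/
lemma regular_endpoint (hn : 2 < n) (hL : IsPolyDiffOpOfOrder n a)
    (hp : IsAdmissibleWeight I p) (h0 : a 0 = 0) (hsa : IsSelfAdjointFor n a I p)
    (hIm : MeasurableSet I) (hI0 : I ⊆ Set.Ici 0)
    {δ₀ : ℝ} (hδ₀ : 0 < δ₀) (hI : Set.Ioo 0 δ₀ ⊆ I)
    (hreg : X ^ (a n).natTrailingDegree ∣ X * weightNum n a) :
    n ≤ 2 * (a n).natTrailingDegree ∧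
      (a (n - 1)).rootMultiplicity 0 + 1 = (a n).natTrailingDegree := by
  have hL0 := hL.leading_ne_zero
  obtain ⟨δ, hδ, hδI, hsm, hpos⟩ := hp.exists_Ioo hδ₀ hI
  set N := weightNum n a with hNdef
  set m := (a n).natTrailingDegree with hm
  have hα : (a n).coeff m ≠ 0 := trailingCoeff_nonzero_iff_nonzero.2 hL0
  obtain ⟨c, hc, hlim⟩ := exists_tendsto_mul_rpow hδ (hsm.differentiableOn (by simp)) hpos
    (fun x hx => weight_ode h0 hL0 hsa isOpen_Ioo hδI hsm hpos hx)
    (X_pow_natTrailingDegree_dvd (a n)) hα hreg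
  set s := (X * N).coeff m / (a n).coeff m with hs
  have hs1 : -1 < s := neg_one_lt_of_integrableOn hδ hc
    (by simpa using (hp.integrable 1).mono_set hδI) hlim
  have hnm : n ≤ 2 * m := by
    -- `d` is the largest of the truncated differences `k - ord a_k`. If it is zero, then already `n
    -- ≤ m`; otherwise `k₀` supplies a nonzero coefficient in the Gamma sums.
    obtain ⟨k₀, hk₀, hmax⟩ := Finset.exists_max_image
      ((Finset.range (n + 1)).filter fun k => a k ≠ 0) (fun k => k - (a k).natTrailingDegree)
      ⟨n, by simp [hL0]⟩
    simp only [Finset.mem_filter, Finset.mem_range] at hk₀ hmax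
    set d := k₀ - (a k₀).natTrailingDegree with hd
    have hdm : n - m ≤ d := hmax n ⟨by omega, hL0⟩
    rcases Nat.eq_zero_or_pos d with hd0 | hdpos
    · omega
    have hdvd : ∀ k ≤ n, X ^ (k - d) ∣ a k := fun k hk => by
      by_cases hak : a k = 0
      · simp [hak]
      · have := hmax k ⟨by omega, hak⟩
        exact (pow_dvd_pow X (by omega)).trans (X_pow_natTrailingDegree_dvd (a k))
    have h2d := two_mul_le_of_sum_Gamma (c := fun i => (-1) ^ (i + d) * (a (i + d)).coeff i)
      (n := n) (d := d) (by omega) hs1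
      (fun j hj => sum_coeff_mul_Gamma_eq_zero hp h0 hsa hIm hI0 hδ hδI hs1 hc hlim (by omega)
        hdvd hj)
      ⟨(a k₀).natTrailingDegree, by omega, by
        have e : (a k₀).natTrailingDegree + d = k₀ := by omega
        rw [e]
        exact mul_ne_zero (by simp) (trailingCoeff_nonzero_iff_nonzero.2 hk₀.2)⟩
    omega
  refine ⟨hnm, ?_⟩
  obtain ⟨m', hm'⟩ : ∃ m', m = m' + 1 := ⟨m - 1, by omega⟩
  have hNc : N.coeff m' = s * (a n).coeff m := by
    rw [hs, div_mul_cancel₀ _ hα, hm', coeff_X_mul]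
  have hnn : (n : ℝ) ≠ 0 := by exact_mod_cast (by omega : n ≠ 0)
  suffices hord : (a (n - 1)).rootMultiplicity 0 = m' by rw [hord, hm']
  refine rootMultiplicity_zero_eq (fun i hi => ?_) ?_
  · have h1 : N.coeff i = 0 := by
      have := X_pow_dvd_iff.1 hreg (i + 1) (by omega)
      rwa [coeff_X_mul] at this
    rw [weightNum_coeff (by omega), ← hNdef, h1,
      coeff_eq_zero_of_lt_natTrailingDegree (by omega)]
    simp
  · rw [weightNum_coeff (by omega), ← hNdef, hNc, ← hm']
    -- The coefficient of `x^(m-1)` in `a_{n-1}` is `(n/2) α (s + m)`, with `α` the trailing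
    -- coefficient of `a_n`; `s > -1` and `m ≥ 1` keep it from vanishing.
    have hsm' : s + (m' + 1 : ℝ) ≠ 0 := by
      have := Nat.cast_nonneg (α := ℝ) m'
      intro h; linarith
    have : n / 2 * (s * (a n).coeff m + (a n).coeff m * (m' + 1)) =
      n / 2 * (a n).coeff m * (s + (m' + 1)) := by ring
    rw [this]
    exact mul_ne_zero (mul_ne_zero (by positivity) hα) hsm'

/-- The conclusion at the root `r`, with the bound of the multiplicity by half the order. -/
def EndpointMultiplicities (n : ℕ) (a : ℕ → ℝ[X]) (r : ℝ) : Prop :=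
  n ≤ 2 * (a n).rootMultiplicity r ∧ 2 ≤ (a n).rootMultiplicity r ∧
    0 < (a (n - 1)).rootMultiplicity r ∧
    (a (n - 1)).rootMultiplicity r < (a n).rootMultiplicity r

lemma endpoint_zero (hn : 2 < n) (hL : IsPolyDiffOpOfOrder n a)
    (hp : IsAdmissibleWeight I p) (h0 : a 0 = 0) (hsa : IsSelfAdjointFor n a I p)
    (hIm : MeasurableSet I) (hI0 : I ⊆ Set.Ici 0)
    {δ₀ : ℝ} (hδ₀ : 0 < δ₀) (hI : Set.Ioo 0 δ₀ ⊆ I) : EndpointMultiplicities n a 0 := by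
  unfold EndpointMultiplicities
  rw [rootMultiplicity_eq_natTrailingDegree' (p := a n)]
  by_cases hreg : X ^ (a n).natTrailingDegree ∣ X * weightNum n a
  · have := regular_endpoint hn hL hp h0 hsa hIm hI0 hδ₀ hI hreg
    omega
  · have := irregular_endpoint hn hL hp h0 hsa hδ₀ hI hreg
    omega

end Endpoint

/-! ### Transport of an arbitrary endpoint to zero by translation and reflection. -/

section Affine

/-- The polynomial `r + ε X`. -/
noncomputable def affinePoly (ε r : ℝ) : ℝ[X] := C r + C ε * X

/-- The coefficients of the operator `∑ a_k D ^ k` in the variable `z` with `x = r + ε z`, for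
`ε = ± 1`. -/
noncomputable def affineCoeff (ε r : ℝ) (a : ℕ → ℝ[X]) (k : ℕ) : ℝ[X] :=
  C (ε ^ k) * (a k).comp (affinePoly ε r)

variable {ε : ℝ} {n : ℕ} {a : ℕ → ℝ[X]} {I : Set ℝ} {p : ℝ → ℝ}

lemma eval_affinePoly (ε r x : ℝ) : (affinePoly ε r).eval x = r + ε * x := by simp [affinePoly]

lemma natDegree_affinePoly (hε : ε * ε = 1) (r : ℝ) : (affinePoly ε r).natDegree = 1 := by
  have : ε ≠ 0 := by rintro rfl; simp at hε
  rw [affinePoly, add_comm]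
  exact natDegree_linear this

lemma natDegree_affineCoeff (hε : ε * ε = 1) (r : ℝ) (k : ℕ) :
    (affineCoeff ε r a k).natDegree = (a k).natDegree := by
  have : ε ≠ 0 := by rintro rfl; simp at hε
  rw [affineCoeff, natDegree_C_mul (pow_ne_zero _ this), natDegree_comp,
    natDegree_affinePoly hε, mul_one]

lemma comp_affinePoly_comp (hε : ε * ε = 1) (r : ℝ) (f : ℝ[X]) :
    (f.comp (affinePoly ε r)).comp (C ε * (X - C r)) = f := by
  rw [comp_assoc]
  have : (affinePoly ε r).comp (C ε * (X - C r)) = X := by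
    simp only [affinePoly, add_comp, C_comp, mul_comp, X_comp]
    have : C ε * C ε = (1 : ℝ[X]) := by rw [← C_mul, hε, C_1]
    linear_combination (X - C r) * this
  rw [this, comp_X]

lemma affineCoeff_ne_zero (hε : ε * ε = 1) (r : ℝ) {k : ℕ} (hk : a k ≠ 0) :
    affineCoeff ε r a k ≠ 0 := by
  have h : ε ≠ 0 := by rintro rfl; simp at hε
  refine mul_ne_zero (by simpa using pow_ne_zero k h) fun h => hk ?_
  rw [← comp_affinePoly_comp hε r (a k), h, zero_comp]

lemma rootMultiplicity_affineCoeff (hε : ε * ε = 1) (r : ℝ) (k : ℕ) :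
    (affineCoeff ε r a k).rootMultiplicity 0 = (a k).rootMultiplicity r := by
  have h : ε ≠ 0 := by rintro rfl; simp at hε
  by_cases hk : a k = 0
  · simp [affineCoeff, hk]
  have hu : IsUnit (C (ε ^ k) : ℝ[X]) := isUnit_C.2 (pow_ne_zero k h).isUnit
  have hu' : IsUnit (C ε : ℝ[X]) := isUnit_C.2 h.isUnit
  refine eq_of_forall_le_iff fun j => ?_
  rw [le_rootMultiplicity_iff (affineCoeff_ne_zero hε r hk), le_rootMultiplicity_iff hk,
    affineCoeff, hu.dvd_mul_left, C_0, sub_zero]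
  constructor
  · rintro ⟨g, hg⟩
    have := congrArg (fun f => f.comp (C ε * (X - C r))) hg
    simp only [comp_affinePoly_comp hε, mul_comp, X_pow_comp, mul_pow] at this
    rw [this]
    exact ⟨C ε ^ j * g.comp (C ε * (X - C r)), by ring⟩
  · rintro ⟨g, hg⟩
    rw [hg, mul_comp, pow_comp, sub_comp, X_comp, C_comp, affinePoly, add_sub_cancel_left, mul_pow]
    exact ⟨C ε ^ j * g.comp (C r + C ε * X), by ring⟩

lemma IsPolyDiffOpOfOrder.affine (hL : IsPolyDiffOpOfOrder n a) (hε : ε * ε = 1) (r : ℝ) :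
    IsPolyDiffOpOfOrder n (affineCoeff ε r a) where
  leading_ne_zero := affineCoeff_ne_zero hε r hL.leading_ne_zero
  natDegree_le k hk := by rw [natDegree_affineCoeff hε]; exact hL.natDegree_le k hk

lemma continuous_affine (ε r : ℝ) : Continuous fun x : ℝ => r + ε * x := by fun_prop

lemma injective_affine (hε : ε * ε = 1) (r : ℝ) : Function.Injective fun x : ℝ => r + ε * x := by
  intro x y h
  have h : ε * x = ε * y := by simpa using h
  exact mul_left_cancel₀ (by rintro rfl; simp at hε) h

lemma measurePreserving_affine (hε : ε * ε = 1) (r : ℝ) :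
    MeasurePreserving (fun x : ℝ => r + ε * x) := by
  rcases mul_self_eq_one_iff.1 hε with rfl | rfl
  · simpa using measurePreserving_add_left volume r
  · have := (measurePreserving_add_left volume r).comp (Measure.measurePreserving_neg volume)
    simpa [Function.comp_def] using this

lemma setIntegral_affine (hε : ε * ε = 1) (r : ℝ) (F : ℝ → ℝ) :
    ∫ x in (fun x => r + ε * x) ⁻¹' I, F (r + ε * x) = ∫ x in I, F x :=
  (measurePreserving_affine hε r).setIntegral_preimage_emb
    ((continuous_affine ε r).measurableEmbedding (injective_affine hε r)) F I

lemma integrableOn_affine (hε : ε * ε = 1) (r : ℝ) {F : ℝ → ℝ} (hF : IntegrableOn F I) :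
    IntegrableOn (fun x => F (r + ε * x)) ((fun x => r + ε * x) ⁻¹' I) :=
  ((measurePreserving_affine hε r).integrableOn_comp_preimage
    ((continuous_affine ε r).measurableEmbedding (injective_affine hε r))).2 hF

lemma IsAdmissibleWeight.affine (hp : IsAdmissibleWeight I p) (hε : ε * ε = 1) (r : ℝ) :
    IsAdmissibleWeight ((fun x => r + ε * x) ⁻¹' I) (fun x => p (r + ε * x)) where
  piecewise_smooth_pos := by
    obtain ⟨S, hS, hsm, hpos⟩ := hp.piecewise_smooth_pos
    refine ⟨(fun x => r + ε * x) ⁻¹' S, hS.preimage (injective_affine hε r).injOn, ?_,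
      fun x hx => hpos _ ⟨hx.1, hx.2⟩⟩
    exact hsm.comp (contDiff_const.add (contDiff_const.mul contDiff_id)).contDiffOn
      fun x hx => ⟨hx.1, hx.2⟩
  integrable u := by
    have h := integrableOn_affine hε r (hp.integrable (u.comp (C ε * (X - C r))))
    refine h.congr (Eventually.of_forall fun x => ?_)
    simp only [eval_comp, eval_mul, eval_C, eval_sub, eval_X]
    rw [show ε * (r + ε * x - r) = x by linear_combination x * hε]

lemma iteratedDeriv_comp_affine {y : ℝ → ℝ} (hy : ContDiff ℝ ∞ y) (ε r : ℝ) (k : ℕ) (x : ℝ) :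
    iteratedDeriv k (fun x => y (r + ε * x)) x = ε ^ k * iteratedDeriv k y (r + ε * x) := by
  have h := iteratedDeriv_comp_const_mul (n := k) (f := fun z => y (r + z))
    ((hy.comp (contDiff_const.add contDiff_id)).of_le (by exact_mod_cast le_top)) ε
  rw [h, iteratedDeriv_comp_const_add]

lemma polyDiffOp_affine (hε : ε * ε = 1) (r : ℝ) {y : ℝ → ℝ} (hy : ContDiff ℝ ∞ y) (x : ℝ) :
    polyDiffOp n (affineCoeff ε r a) (fun x => y (r + ε * x)) x =
      polyDiffOp n a y (r + ε * x) := by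
  refine Finset.sum_congr rfl fun k _ => ?_
  rw [iteratedDeriv_comp_affine hy, affineCoeff, eval_mul, eval_C, eval_comp, eval_affinePoly]
  have : ε ^ k * ε ^ k = 1 := by rw [← mul_pow, hε, one_pow]
  linear_combination (a k).eval (r + ε * x) * iteratedDeriv k y (r + ε * x) * this

lemma IsSelfAdjointFor.affine (hsa : IsSelfAdjointFor n a I p) (hε : ε * ε = 1) (r : ℝ) :
    IsSelfAdjointFor n (affineCoeff ε r a) ((fun x => r + ε * x) ⁻¹' I)
      (fun x => p (r + ε * x)) := by
  intro y u hy hu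
  have hinv : ∀ x, ε * (r + ε * x - r) = x := fun x => by linear_combination x * hε
  have hy' : Function.HasTemperateGrowth fun z => y (ε * (z - r)) := hy.comp (by fun_prop)
  have hu' : Function.HasTemperateGrowth fun z => u (ε * (z - r)) := hu.comp (by fun_prop)
  have ey : ∀ x, polyDiffOp n (affineCoeff ε r a) y x =
      polyDiffOp n a (fun z => y (ε * (z - r))) (r + ε * x) := fun x => by
    rw [← polyDiffOp_affine hε r hy'.1]; simp only [hinv]
  have eu : ∀ x, polyDiffOp n (affineCoeff ε r a) u x =
      polyDiffOp n a (fun z => u (ε * (z - r))) (r + ε * x) := fun x => by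
    rw [← polyDiffOp_affine hε r hu'.1]; simp only [hinv]
  have h := hsa _ _ hy' hu'
  have h1 := setIntegral_affine (I := I) hε r fun x =>
    p x * polyDiffOp n a (fun z => y (ε * (z - r))) x * u (ε * (x - r))
  have h2 := setIntegral_affine (I := I) hε r fun x =>
    p x * y (ε * (x - r)) * polyDiffOp n a (fun z => u (ε * (z - r))) x
  simp only [hinv] at h1 h2
  simp only [weightedInner, ey, eu] at h ⊢
  rw [h1, h2, h]

lemma endpoint (hn : 2 < n) (hL : IsPolyDiffOpOfOrder n a)
    (hp : IsAdmissibleWeight I p) (h0 : a 0 = 0) (hsa : IsSelfAdjointFor n a I p)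
    (hIm : MeasurableSet I) (hε : ε * ε = 1) {r : ℝ} (hI0 : ∀ x ∈ I, 0 ≤ ε * (x - r))
    {δ : ℝ} (hδ : 0 < δ) (hI : ∀ x ∈ Set.Ioo 0 δ, r + ε * x ∈ I) :
    EndpointMultiplicities n a r := by
  have h := endpoint_zero hn (hL.affine hε r) (hp.affine hε r) (by simp [affineCoeff, h0])
    (hsa.affine hε r) ((continuous_affine ε r).measurable hIm)
    (fun x hx => by
      have := hI0 _ hx
      rwa [show ε * (r + ε * x - r) = x by linear_combination x * hε] at this) hδ hI
  unfold EndpointMultiplicities at h ⊢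
  rwa [rootMultiplicity_affineCoeff hε, rootMultiplicity_affineCoeff hε] at h

lemma weightNum_affine (hε : ε * ε = 1) (r : ℝ) (hn : n ≠ 0) :
    weightNum n (affineCoeff ε r a) = C (ε ^ (n + 1)) * (weightNum n a).comp (affinePoly ε r) := by
  obtain ⟨m, rfl⟩ : ∃ m, n = m + 1 := ⟨n - 1, by omega⟩
  simp only [weightNum, affineCoeff, Nat.add_sub_cancel, derivative_mul, derivative_C, zero_mul,
    zero_add, derivative_comp, sub_comp, mul_comp, C_comp]
  have h1 : derivative (affinePoly ε r) = C ε := by simp [affinePoly]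
  have h2 : C ε * C ε = (1 : ℝ[X]) := by rw [← C_mul, hε, C_1]
  rw [h1]
  simp only [C_pow]
  linear_combination -C (2 / ((m + 1 : ℕ) : ℝ)) * C ε ^ m * (a m).comp (affinePoly ε r) * h2

/-- On the whole line the leading coefficient is constant. -/
lemma natDegree_eq_zero_of_univ (hL : IsPolyDiffOpOfOrder n a)
    (hp : IsAdmissibleWeight Set.univ p) (h0 : a 0 = 0)
    (hsa : IsSelfAdjointFor n a Set.univ p) : (a n).natDegree = 0 := by
  have hn0 : n ≠ 0 := fun h => hL.leading_ne_zero (h ▸ h0)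
  have hε : (-1 : ℝ) * -1 = 1 := by norm_num
  have h1 := (infinite_end hL hp h0 hsa (Set.subset_univ (Set.Ioi 0))).2
  have h2 := (infinite_end (hL.affine hε 0) (hp.affine hε 0) (by simp [affineCoeff, h0])
    (hsa.affine hε 0) (R₀ := 0) (by simp)).2
  rw [natDegree_affineCoeff hε] at h2
  rcases h1 with h1 | ⟨h1, h1'⟩
  · exact h1
  rcases h2 with h2 | ⟨-, h2'⟩
  · exact h2
  -- Otherwise `p'/p` would have a negative limit at `+∞` and, after reflection, also one at `-∞`;
  -- but reflection changes the sign of `p'/p`, while the two limits of the ratio of polynomials of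
  -- equal degree agree.
  exfalso
  have hd : (affinePoly (-1) 0).natDegree ≠ 0 := by rw [natDegree_affinePoly hε]; simp
  rw [weightNum_affine hε 0 hn0, affineCoeff, leadingCoeff_mul, leadingCoeff_mul, leadingCoeff_C,
    leadingCoeff_C, leadingCoeff_comp hd, leadingCoeff_comp hd, h1, pow_succ] at h2'
  have hl : (affinePoly (-1) 0).leadingCoeff ≠ 0 := by
    rw [leadingCoeff_ne_zero]; rintro h; simp [h] at hd
  have hlc := leadingCoeff_ne_zero.2 hL.leading_ne_zero
  have hlp := pow_ne_zero (a n).natDegree hl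
  have hnp : (-1 : ℝ) ^ n ≠ 0 := by simp
  have e : (-1 : ℝ) ^ n * -1 * ((weightNum n a).leadingCoeff *
      (affinePoly (-1) 0).leadingCoeff ^ (a n).natDegree) / ((-1) ^ n * ((a n).leadingCoeff *
      (affinePoly (-1) 0).leadingCoeff ^ (a n).natDegree)) =
      -((weightNum n a).leadingCoeff / (a n).leadingCoeff) := by
    field_simp
  rw [e] at h2'
  linarith

end Affine

/-! ### Counting roots: every real root is an endpoint. -/

lemma sum_rootMultiplicity_le (f : ℝ[X]) (s : Finset ℝ) :
    ∑ x ∈ s, f.rootMultiplicity x ≤ f.natDegree := by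
  classical
  refine le_trans ?_ f.card_roots'
  simp_rw [← count_roots]
  rw [← Multiset.sum_count_eq_card (s := s ∪ f.roots.toFinset) (m := f.roots) (by
    intro x hx; simp at hx ⊢; tauto)]
  exact Finset.sum_le_sum_of_subset Finset.subset_union_left

/-- A root off the endpoints would exceed the degree: two finite endpoints already use up `n`, one
uses up the `n/2` allowed by the infinite end, and on the line the degree is zero. -/
lemma endpointMultiplicities_of_isRoot {n : ℕ} (hn : 2 < n) {a : ℕ → ℝ[X]} (h0 : a 0 = 0)
    (hL : IsPolyDiffOpOfOrder n a) {I : Set ℝ} (hI : I.OrdConnected) (hI' : I.Nontrivial)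
    {p : ℝ → ℝ} (hp : IsAdmissibleWeight I p) (hsa : IsSelfAdjointFor n a I p)
    {r : ℝ} (hr : (a n).IsRoot r) : EndpointMultiplicities n a r := by
  have hIm : MeasurableSet I := hI.measurableSet
  have hrpos : 0 < (a n).rootMultiplicity r := (rootMultiplicity_pos hL.leading_ne_zero).2 hr
  have hdeg : (a n).natDegree ≤ n := hL.natDegree_le n (Finset.mem_Icc.2 ⟨by omega, le_rfl⟩)
  obtain ⟨x₀, hx₀, y₀, hy₀, hxy⟩ := hI'.exists_lt
  have hne : I.Nonempty := ⟨x₀, hx₀⟩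
  have low : BddBelow I → sInf I < y₀ ∧ Set.Ioc (sInf I) y₀ ⊆ I ∧
      EndpointMultiplicities n a (sInf I) := by
    intro hb
    have h1 : sInf I < y₀ := (csInf_le hb hx₀).trans_lt hxy
    have h2 : Set.Ioc (sInf I) y₀ ⊆ I := fun z hz => by
      obtain ⟨w, hw, hwz⟩ := exists_lt_of_csInf_lt hne hz.1
      exact hI.out hw hy₀ ⟨hwz.le, hz.2⟩
    refine ⟨h1, h2, endpoint (ε := 1) hn hL hp h0 hsa hIm (by norm_num) (fun x hx => ?_)
      (sub_pos.2 h1) fun x hx => h2 ⟨by linarith [hx.1], by linarith [hx.2]⟩⟩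
    have := csInf_le hb hx
    linarith
  have high : BddAbove I → x₀ < sSup I ∧ Set.Ico x₀ (sSup I) ⊆ I ∧
      EndpointMultiplicities n a (sSup I) := by
    intro hb
    have h1 : x₀ < sSup I := hxy.trans_le (le_csSup hb hy₀)
    have h2 : Set.Ico x₀ (sSup I) ⊆ I := fun z hz => by
      obtain ⟨w, hw, hwz⟩ := exists_lt_of_lt_csSup hne hz.2
      exact hI.out hx₀ hw ⟨hz.1, hwz.le⟩
    refine ⟨h1, h2, endpoint (ε := -1) hn hL hp h0 hsa hIm (by norm_num) (fun x hx => ?_)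
      (sub_pos.2 h1) fun x hx => h2 ⟨by linarith [hx.2], by linarith [hx.1]⟩⟩
    have := le_csSup hb hx
    linarith
  by_cases hb : BddBelow I <;> by_cases ht : BddAbove I
  · obtain ⟨hc1, -, hc⟩ := low hb
    obtain ⟨hd1, -, hd⟩ := high ht
    by_cases hrc : r = sInf I
    · rwa [hrc]
    by_cases hrd : r = sSup I
    · rwa [hrd]
    have hcd : sInf I ≠ sSup I := ((csInf_le hb hx₀).trans_lt hd1).ne
    have h := sum_rootMultiplicity_le (a n) {r, sInf I, sSup I}
    rw [Finset.sum_insert (by simp [hrc, hrd]), Finset.sum_pair hcd] at h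
    have := hc.1
    have := hd.1
    omega
  · obtain ⟨hc1, hsub, hc⟩ := low hb
    by_cases hrc : r = sInf I
    · rwa [hrc]
    have hIoi : Set.Ioi y₀ ⊆ I := fun z hz => by
      obtain ⟨w, hw, hzw⟩ := not_bddAbove_iff.1 ht z
      exact hI.out hy₀ hw ⟨le_of_lt hz, hzw.le⟩
    have hinf := (infinite_end hL hp h0 hsa hIoi).1
    have h := sum_rootMultiplicity_le (a n) {r, sInf I}
    rw [Finset.sum_pair hrc] at h
    have := hc.1
    omega
  · obtain ⟨hd1, hsub, hd⟩ := high ht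
    by_cases hrd : r = sSup I
    · rwa [hrd]
    have hε : (-1 : ℝ) * -1 = 1 := by norm_num
    have hIoi : Set.Ioi (-x₀) ⊆ (fun x => 0 + -1 * x) ⁻¹' I := fun z hz => by
      have hz : -x₀ < z := hz
      obtain ⟨w, hw, hzw⟩ := not_bddBelow_iff.1 hb (-z)
      exact hI.out hw hx₀ ⟨by linarith, by linarith⟩
    have hinf := (infinite_end (hL.affine hε 0) (hp.affine hε 0) (by simp [affineCoeff, h0])
      (hsa.affine hε 0) hIoi).1
    rw [natDegree_affineCoeff hε] at hinf
    have h := sum_rootMultiplicity_le (a n) {r, sSup I}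
    rw [Finset.sum_pair hrd] at h
    have := hd.1
    omega
  · have hu : I = Set.univ := Set.eq_univ_of_forall fun z => by
      obtain ⟨w, hw, hzw⟩ := not_bddAbove_iff.1 ht z
      obtain ⟨v, hv, hvz⟩ := not_bddBelow_iff.1 hb z
      exact hI.out hv hw ⟨hvz.le, hzw.le⟩
    subst hu
    have h := natDegree_eq_zero_of_univ hL hp h0 hsa
    have h' := sum_rootMultiplicity_le (a n) {r}
    rw [Finset.sum_singleton] at h'
    omega

theorem proposition3p4 (n : ℕ) (hn : 2 < n) (a : ℕ → ℝ[X]) (hL : IsPolyDiffOpOfOrder n a)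
    (I : Set ℝ) (hI : I.OrdConnected) (hI' : I.Nontrivial)
    (p : ℝ → ℝ) (hp : IsAdmissibleWeight I p) (hsa : IsSelfAdjointFor n a I p)
    (r : ℝ) (hr : (a n).IsRoot r) :
    2 ≤ (a n).rootMultiplicity r ∧
      0 < (a (n - 1)).rootMultiplicity r ∧
      (a (n - 1)).rootMultiplicity r < (a n).rootMultiplicity r := by
  -- The operator starts at `k = 1`, so `a 0` is arbitrary data; setting it to zero allows sums over
  -- all `k ≤ n`.
  have hupd : ∀ k, k ≠ 0 → Function.update a 0 0 k = a k := fun k hk =>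
    Function.update_of_ne hk _ _
  have hop : polyDiffOp n (Function.update a 0 0) = polyDiffOp n a := by
    ext y x
    refine Finset.sum_congr rfl fun k hk => ?_
    rw [hupd k (by simp at hk; omega)]
  have h := (endpointMultiplicities_of_isRoot (a := Function.update a 0 0) hn (by simp)
    ⟨by rw [hupd n (by omega)]; exact hL.leading_ne_zero, fun k hk => by
      rw [hupd k (by simp at hk; omega)]; exact hL.natDegree_le k hk⟩ hI hI' hp
    (by unfold IsSelfAdjointFor; rw [hop]; exact hsa) (r := r)
    (by rw [hupd n (by omega)]; exact hr)).2
  rwa [hupd n (by omega), hupd (n - 1) (by omega)] at h
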